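/- **Theorem (Single-shot decoding for extremely low noise rates).** *Setting.* For integers $0\le k\le n$, $n\ge 1$, let $\mathsf{Stab}(n,k)$ be the set of stabilizer subgroups with $n-k$ independent generators, i.e. of abelian groups $S=\langle g_1,\dots,g_{n-k}\rangle\subseteq\{\pm P_1\otimes\cdots\otimes P_n : P_i\in\{I,X,Y,Z\}\}$ of order $2^{n-k}$ with $-I\notin S$; let $C(S)$ be the common $+1$ eigenspace of $S$. An *encoding circuit* for $S$ is a circuit over the Clifford gates $H$, $R_{\pi/4}=\mathrm{diag}(1,i)$, $\mathrm{CNOT}$ whose unitary $U$ satisfies $U(|0^{n-k}\rangle\otimes|\psi\rangle)\in C(S)$ for all $|\psi\rangle\in(\mathbb C^2)^{\otimes k}$. An *encoding finder* is a classical (random-access machine) algorithm that, for all such $n,k$, all $S\in\mathsf{Stab}(n,k)$ and all generators $g_1,\dots,g_{n-k}$ of $S$, given $g_1,\dots,g_{n-k}$ as input, writes down in time $O(n^3)$ an encoding circuit for $S$ with $O(n^2)$ gates. Fix an encoding finder and, for every $S$, a classical description of $S$ by $n-k$ generators; the canonical encoding $U^S_{\mathrm{Enc}}$ is the encoding that the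 finder writes down on this description. With $|\overline{\psi_x}\rangle^S=U^S_{\mathrm{Enc}}(|0^{n-k}\rangle\otimes|x\rangle)$ and $$\mathcal D_p^{\otimes n}(\rho)=\sum_{E\in\{I,X,Y,Z\}^{\otimes n}}\Big(\frac p3\Big)^{|E|}(1-p)^{n-|E|}\,E\rho E^\dagger ,$$ the problem $\mathsf{LSN}_{n,k,\mathcal D_p^{\otimes n}}$ is to find $x$ from (the description of) $S$ and the state $\mathcal D_p^{\otimes n}(|\overline{\psi_x}\rangle\langle\overline{\psi_x}|^S)$, for uniformly random $S\in\mathsf{Stab}(n,k)$ and uniformly random $x\in\{0,1\}^k$. *Algorithm 1* runs the finder on the description of $S$ to obtain a circuit for $U^S_{\mathrm{Enc}}$, applies the inverse circuit to the given state, measures all $n$ qubits in the computational basis, and outputs the last $k$ bits of the outcome. Its running time is the number of steps of the finder plus the number of gates of the inverse circuit plus $n$ (measurements) plus $k$ (output). *Claim.* An encoding finder exists. For every encoding finder: 1. Algorithm 1 runs in time $O(n^3)$: there is a constant $C$ such that for all $n\ge1$, $k\le n$, it takes at most $Cn^3$ steps on every description of every $S\in\mathsf{Stab}(n,k)$. In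 particular, if $n=n(k)$ is bounded by a polynomial in $k$, then it runs in time $\mathrm{poly}(k)$. 2. For all $n\ge 1$, $k\le n$ and every choice of the descriptions, for the noise rate $p=1/n$, Algorithm 1 solves $\mathsf{LSN}_{n,k,\mathcal D_p^{\otimes n}}$ with probability at least $0.25$ over the choice of $S$ and $x$, the noise and the measurement. -/

import Mathlib

open scoped Matrix

namespace LSN

/-! ### Qubits, Pauli operators -/

/-- Bit strings of length `n`; they label the computational basis of `n` qubits. -/
abbrev Bits (n : ℕ) : Type := Fin n → Fin 2

/-- Linear operators on `n` qubits, as matrices in the computational basis. -/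
abbrev Op (n : ℕ) : Type := Matrix (Bits n) (Bits n) ℂ

/-- The tensor product `M 0 ⊗ M 1 ⊗ ⋯ ⊗ M (n-1)` of single-qubit operators. -/
def tensor {n : ℕ} (M : Fin n → Matrix (Fin 2) (Fin 2) ℂ) : Op n :=
  Matrix.of fun a b => ∏ i, M i (a i) (b i)

/-- The four single-qubit Pauli labels. -/
inductive Pauli : Type where
  | I | X | Y | Z
  deriving DecidableEq

namespace Pauli

instance : Fintype Pauli := ⟨{I, X, Y, Z}, fun P => by cases P <;> simp⟩

/-- The Pauli matrices. -/
noncomputable def mat : Pauli → Matrix (Fin 2) (Fin 2) ℂ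
  | I => 1
  | X => !![0, 1; 1, 0]
  | Y => !![0, -Complex.I; Complex.I, 0]
  | Z => !![1, 0; 0, -1]

/-- The `X`-bit of the symplectic representation. -/
def xBit : Pauli → ℕ
  | I => 0
  | X => 1
  | Y => 1
  | Z => 0

/-- The `Z`-bit of the symplectic representation. -/
def zBit : Pauli → ℕ
  | I => 0
  | X => 0
  | Y => 1
  | Z => 1

end Pauli

/-- Unsigned `n`-qubit Pauli operators. -/
abbrev PauliString (n : ℕ) : Type := Fin n → Pauli

/-- The operator `P_1 ⊗ ⋯ ⊗ P_n`. -/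
noncomputable def PauliString.mat {n : ℕ} (P : PauliString n) : Op n :=
  tensor fun i => (P i).mat

/-- The weight of a Pauli operator: the number of qubits on which it is not the identity. -/
def PauliString.weight {n : ℕ} (P : PauliString n) : ℕ :=
  (Finset.univ.filter fun i => P i ≠ Pauli.I).card

/-- Signed Pauli operators `± P_1 ⊗ ⋯ ⊗ P_n`: a sign (`true` for minus) and a Pauli string. -/
abbrev SignedPauli (n : ℕ) : Type := Bool × PauliString n

/-- The operator of a signed Pauli. Distinct signed Paulis have distinct operators. -/
noncomputable def SignedPauli.mat {n : ℕ} (P : SignedPauli n) : Op n :=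
  (if P.1 then (-1 : ℂ) else 1) • PauliString.mat P.2

/-! ### Stabilizer subgroups -/

/-- The operators in `S` are exactly the products of the operators `g 0, g 1, …`. As a signed
Pauli operator is its own inverse, this says that `S` is the group generated by the `g i`. -/
def Generates {n m : ℕ} (g : Fin m → SignedPauli n) (S : Finset (SignedPauli n)) : Prop :=
  SignedPauli.mat '' (S : Set (SignedPauli n)) =
    (Submonoid.closure (Set.range fun i => SignedPauli.mat (g i)) : Set (Op n))

/-- `S` is a stabilizer subgroup with `n - k` (independent) generators: an abelian group of signed
`n`-qubit Pauli operators of order `2 ^ (n - k)`, generated by `n - k` of them, without `-1`. -/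
def IsStabilizer {n : ℕ} (k : ℕ) (S : Finset (SignedPauli n)) : Prop :=
  (∃ g : Fin (n - k) → SignedPauli n, Generates g S) ∧
  (∀ P ∈ S, ∀ Q ∈ S, SignedPauli.mat P * SignedPauli.mat Q
      = SignedPauli.mat Q * SignedPauli.mat P) ∧
  ((true, fun _ => Pauli.I) : SignedPauli n) ∉ S ∧
  S.card = 2 ^ (n - k)

/-- `Stab(n, k)`. -/
abbrev Stab (n k : ℕ) : Type := {S : Finset (SignedPauli n) // IsStabilizer k S}

noncomputable instance (n k : ℕ) : Fintype (Stab n k) := Fintype.ofFinite _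

/-- The code space `C(S)`: the common `+1` eigenspace of all elements of `S`. -/
def codeSpace {n : ℕ} (S : Finset (SignedPauli n)) : Set (Bits n → ℂ) :=
  {v | ∀ P ∈ S, SignedPauli.mat P *ᵥ v = v}

/-! ### Clifford circuits and encodings -/

/-- The Clifford gates Hadamard, phase (`R_{π/4}`) and CNOT (control, target) on `n` qubits. -/
inductive Gate (n : ℕ) : Type where
  | had (i : Fin n)
  | phase (i : Fin n)
  | cnot (i j : Fin n) (h : i ≠ j)

namespace Gate

variable {n : ℕ}

/-- The unitary of a gate. -/
noncomputable def mat : Gate n → Op n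
  | had i => tensor (Function.update (fun _ => 1) i
      (((Real.sqrt 2 : ℝ) : ℂ)⁻¹ • !![1, 1; 1, -1]))
  | phase i => tensor (Function.update (fun _ => 1) i !![1, 0; 0, Complex.I])
  | cnot i j _ => Matrix.of fun a b => if a = Function.update b j (b j + b i) then 1 else 0

/-- The inverse of a gate, over the same gate set; the inverse phase gate is three phase gates. -/
def inv : Gate n → List (Gate n)
  | had i => [had i]
  | phase i => [phase i, phase i, phase i]
  | cnot i j h => [cnot i j h]

end Gate

/-- A circuit `[U_1, …, U_m]` denotes the operator product `U_1 U_2 ⋯ U_m`. -/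
abbrev Circuit (n : ℕ) : Type := List (Gate n)

/-- The unitary of a circuit. -/
noncomputable def Circuit.mat {n : ℕ} (c : Circuit n) : Op n := (c.map Gate.mat).prod

/-- The inverse circuit. -/
def Circuit.inv {n : ℕ} (c : Circuit n) : Circuit n := c.reverse.flatMap Gate.inv

/-- The last `k` bits of an `n`-bit string. -/
def lastBits {n k : ℕ} (hk : k ≤ n) (b : Bits n) : Bits k :=
  fun i => b ⟨n - k + i, by omega⟩

/-- The `n`-qubit vector `|0^{n-k}⟩ ⊗ ψ`. -/
noncomputable def zeroPad {n k : ℕ} (hk : k ≤ n) (ψ : Bits k → ℂ) : Bits n → ℂ :=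
  fun b => if ∀ j : Fin n, (j : ℕ) < n - k → b j = 0 then ψ (lastBits hk b) else 0

/-- `U` encodes every `k`-qubit state into the code space of `S`. -/
def IsEncoding {n k : ℕ} (hk : k ≤ n) (U : Op n) (S : Finset (SignedPauli n)) : Prop :=
  ∀ ψ : Bits k → ℂ, U *ᵥ zeroPad hk ψ ∈ codeSpace S

/-- The codeword `U (|0^{n-k}⟩ ⊗ |x⟩)`. -/
noncomputable def codeword {n k : ℕ} (hk : k ≤ n) (U : Op n) (x : Bits k) : Bits n → ℂ :=
  U *ᵥ zeroPad hk (Pi.single x 1)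

/-! ### The classical machine model

A random access machine, written as a structured language with scalar registers, two-dimensional
arrays and a write-only output tape for gates. Its only arithmetic is the successor, so after `t`
steps every stored number is at most `t` plus the largest input number; every instruction
therefore works on words of `O(log (input size + t))` bits. -/

/-- A memory: registers and two-dimensional arrays of natural numbers. -/
structure Store : Type where
  reg : ℕ → ℕ
  arr : ℕ → ℕ → ℕ → ℕ

namespace Store

/-- Write `v` into register `x`. -/
def setReg (s : Store) (x v : ℕ) : Store := { s with reg := Function.update s.reg x v }

/-- Write `v` into the array cell `a[i][j]`. -/
def setArr (s : Store) (a i j v : ℕ) : Store :=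
  { s with arr := fun a' i' j' => if a' = a ∧ i' = i ∧ j' = j then v else s.arr a' i' j' }

end Store

/-- A gate as written on the output tape, with wires numbered from `0`. -/
inductive RawGate : Type where
  | had (i : ℕ)
  | phase (i : ℕ)
  | cnot (i j : ℕ)

/-- The notation of a gate on the output tape. -/
def Gate.raw {n : ℕ} : Gate n → RawGate
  | had i => .had i
  | phase i => .phase i
  | cnot i j _ => .cnot i j

/-- Programs. The arguments `x y i j` are names of registers and `a` is the name of an array. -/
inductive Program : Type where
  | skip
  /-- `x := 0` -/
  | zero (x : ℕ)
  /-- `x := x + 1` -/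
  | succ (x : ℕ)
  /-- `x := y` -/
  | copy (x y : ℕ)
  /-- `x := a[i][j]` -/
  | load (x a i j : ℕ)
  /-- `a[i][j] := x` -/
  | store (a i j x : ℕ)
  /-- write a Hadamard gate on wire `i` -/
  | emitHad (i : ℕ)
  /-- write a phase gate on wire `i` -/
  | emitPhase (i : ℕ)
  /-- write a CNOT gate with control `i` and target `j` -/
  | emitCnot (i j : ℕ)
  | seq (c d : Program)
  /-- if `x < y` then `c` else `d` -/
  | ifLt (x y : ℕ) (c d : Program)
  /-- while `x < y` do `c` -/
  | whileLt (x y : ℕ) (c : Program)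

/-- `Exec c s s' o t`: started on the memory `s`, the program `c` halts after exactly `t` steps
with the memory `s'`, having written the list `o` on the output tape. Every elementary
instruction and every test is one step. -/
inductive Exec : Program → Store → Store → List RawGate → ℕ → Prop where
  | skip (s) : Exec .skip s s [] 1
  | zero (s x) : Exec (.zero x) s (s.setReg x 0) [] 1
  | succ (s x) : Exec (.succ x) s (s.setReg x (s.reg x + 1)) [] 1
  | copy (s x y) : Exec (.copy x y) s (s.setReg x (s.reg y)) [] 1
  | load (s x a i j) : Exec (.load x a i j) s (s.setReg x (s.arr a (s.reg i) (s.reg j))) [] 1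
  | store (s a i j x) : Exec (.store a i j x) s (s.setArr a (s.reg i) (s.reg j) (s.reg x)) [] 1
  | emitHad (s i) : Exec (.emitHad i) s s [.had (s.reg i)] 1
  | emitPhase (s i) : Exec (.emitPhase i) s s [.phase (s.reg i)] 1
  | emitCnot (s i j) : Exec (.emitCnot i j) s s [.cnot (s.reg i) (s.reg j)] 1
  | seq {c d s s₁ s₂ o₁ o₂ t₁ t₂} (h₁ : Exec c s s₁ o₁ t₁) (h₂ : Exec d s₁ s₂ o₂ t₂) :
      Exec (.seq c d) s s₂ (o₁ ++ o₂) (t₁ + t₂)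
  | ifTrue {x y c d s s' o t} (hxy : s.reg x < s.reg y) (h : Exec c s s' o t) :
      Exec (.ifLt x y c d) s s' o (t + 1)
  | ifFalse {x y c d s s' o t} (hxy : ¬ s.reg x < s.reg y) (h : Exec d s s' o t) :
      Exec (.ifLt x y c d) s s' o (t + 1)
  | whileTrue {x y c s s₁ s₂ o₁ o₂ t₁ t₂} (hxy : s.reg x < s.reg y) (h₁ : Exec c s s₁ o₁ t₁)
      (h₂ : Exec (.whileLt x y c) s₁ s₂ o₂ t₂) :
      Exec (.whileLt x y c) s s₂ (o₁ ++ o₂) (t₁ + t₂ + 1)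
  | whileFalse {x y c s} (hxy : ¬ s.reg x < s.reg y) : Exec (.whileLt x y c) s s [] 1

/-- The classical description of a stabilizer subgroup as a machine input: `n` and `k` in registers
`0` and `1`; the `X`-bit, the `Z`-bit of generator `i` on qubit `j` in the cells `0[i][j]`,
`1[i][j]`; its sign bit in `2[i][0]`; everything else is zero. -/
def inputStore {n : ℕ} (k : ℕ) (g : Fin (n - k) → SignedPauli n) : Store where
  reg x := if x = 0 then n else if x = 1 then k else 0
  arr a i j :=
    if hi : i < n - k then
      if hj : j < n then
        if a = 0 then ((g ⟨i, hi⟩).2 ⟨j, hj⟩).xBit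
        else if a = 1 then ((g ⟨i, hi⟩).2 ⟨j, hj⟩).zBit
        else if a = 2 ∧ j = 0 ∧ (g ⟨i, hi⟩).1 then 1 else 0
      else 0
    else 0

/-- On the description `g`, the program halts after `t` steps, having written the circuit `c`. -/
def Writes (F : Program) {n : ℕ} (k : ℕ) (g : Fin (n - k) → SignedPauli n) (c : Circuit n)
    (t : ℕ) : Prop :=
  ∃ s', Exec F (inputStore k g) s' (c.map Gate.raw) t

/-- `F` is a classical algorithm that, from generators of any `S ∈ Stab(n, k)`, writes down in time
`O(n ^ 3)` an encoding circuit for `S` with `O(n ^ 2)` Clifford gates. -/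
def FindsEncodings (F : Program) : Prop :=
  ∃ C : ℕ, ∀ (n k : ℕ) (_ : 1 ≤ n) (hk : k ≤ n) (S : Stab n k) (g : Fin (n - k) → SignedPauli n),
    Generates g S.1 → ∃ (c : Circuit n) (t : ℕ), Writes F k g c t ∧ t ≤ C * n ^ 3 ∧
      c.length ≤ C * n ^ 2 ∧ IsEncoding hk c.mat S.1

/-! ### Learning Stabilizers with Noise -/

/-- The local depolarizing channel `D_p^{⊗n}`, which applies the Pauli error `E` with probability
`(p/3)^{|E|} (1-p)^{n-|E|}`. -/
noncomputable def depolarize {n : ℕ} (p : ℝ) (ρ : Op n) : Op n :=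
  ∑ E : PauliString n,
    (((p / 3) ^ E.weight * (1 - p) ^ (n - E.weight) : ℝ) : ℂ) • (E.mat * ρ * E.matᴴ)

/-- The density matrix `D_p^{⊗n}(|ψ_x⟩⟨ψ_x|)` of the noisy codeword `ψ_x = U (|0^{n-k}⟩ ⊗ |x⟩)`. -/
noncomputable def noisyCodeword {n k : ℕ} (hk : k ≤ n) (p : ℝ) (U : Op n) (x : Bits k) : Op n :=
  depolarize p (Matrix.vecMulVec (codeword hk U x) (star (codeword hk U x)))

/-- The probability that an algorithm solves the LSN problem with canonical encodings `enc`, over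
uniformly random `S` and `x`, the noise, and the randomness of the algorithm. Here `A S ρ y` is
the probability that the algorithm outputs `y` on the input `(S, ρ)`. -/
noncomputable def successProb {n k : ℕ} (hk : k ≤ n) (p : ℝ) (enc : Stab n k → Op n)
    (A : Stab n k → Op n → Bits k → ℝ) : ℝ :=
  (∑ S : Stab n k, ∑ x : Bits k, A S (noisyCodeword hk p (enc S) x) x) /
    ((Fintype.card (Stab n k) : ℝ) * 2 ^ k)

/-- The quantum part of Algorithm 1, for the encoding circuit `c` that was found: apply the inverse
circuit to `ρ`, measure all qubits in the computational basis, output the last `k` bits of the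
outcome. This is the probability of the output `y`. -/
noncomputable def algorithm1Output {n k : ℕ} (hk : k ≤ n) (c : Circuit n) (ρ : Op n)
    (y : Bits k) : ℝ :=
  ∑ b ∈ Finset.univ.filter (fun b : Bits n => lastBits hk b = y),
    ((c.inv.mat * ρ * c.inv.matᴴ) b b).re

/-- The running time of Algorithm 1 if its classical part took `t` steps to write the circuit `c`:
then every gate of the inverse circuit, every one of the `n` single-qubit measurements and every
one of the `k` output bits is a step. -/
def algorithm1Time {n : ℕ} (k : ℕ) (c : Circuit n) (t : ℕ) : ℕ :=
  t + c.inv.length + n + k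

/-- Algorithm 1, with `F` as its classical part, runs in time at most `B` on every description of
every `S ∈ Stab(n, k)`. -/
def Algorithm1RunsIn (F : Program) (n k B : ℕ) : Prop :=
  ∀ (S : Stab n k) (g : Fin (n - k) → SignedPauli n), Generates g S.1 →
    ∃ (c : Circuit n) (t : ℕ), Writes F k g c t ∧ algorithm1Time k c t ≤ B

end LSN

open LSN

namespace LSN

variable {n m k : ℕ}

/-! ### Tensor products and Pauli operators -/

/-! The success bound uses only that the decoder undoes a unitary circuit; it holds for any family
of Clifford circuits `enc` (`quarter_le_successProb`). If no error occurs, inverting `U` returns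
`0^{n-k} x` with certainty, and for `n ≥ 2` this has probability `(1 - 1/n)^n ≥ 1/4`
(`quarter_le_pow`). For `n = 1` the noise rate is `1` and an error always occurs. Then `X`, `Y`, `Z`
have probability `1/3` each, and the probabilities that they leave the decoded bit unchanged are the
squared coordinates of a unit Bloch vector, so the bit survives with probability `1/3`
(`stayProb_sum_one`).

The encoding finder is Gaussian elimination on the generators. Gates are appended to a circuit `U`
while every generator `P` is replaced by `U† P U`, until generator `i` has sign `+`, is `Z` on qubit
`i`, `I` on later qubits, and `I` or `Z` on earlier ones (`Reduced`). Such an operator fixes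
`|0^{n-k}⟩ ⊗ ψ`, and `P U = U (U† P U)` shows that `U` encodes into the code space
(`isEncoding_of_reduced`).

The treatment of row `i` touches only qubits from `i` on, where earlier rows are trivial, so these
stay reduced. It finds a pivot because row `i` commutes with the earlier rows: its labels before
qubit `i` must be `I` or `Z` (`lower_of_comm`). If it were also trivial on qubit `i`, it would be
plus or minus a product of earlier rows. Plus contradicts independence, minus puts `-1` into the
group (`IndepGenerators.row_spec`).

There are at most `n` rows, at most `n` columns per row and a bounded number of gates per column,
hence `O(n^2)` gates. Each gate updates at most `n` stored rows in constant time per row, hence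
`O(n^3)` steps. -/

theorem tensor_mul (A B : Fin n → Matrix (Fin 2) (Fin 2) ℂ) :
    tensor A * tensor B = tensor fun i => A i * B i := by
  ext a b
  simp only [tensor, Matrix.mul_apply, Matrix.of_apply, ← Finset.prod_mul_distrib]
  rw [Finset.prod_univ_sum]
  simp

theorem tensor_one : tensor (fun _ : Fin n => 1) = 1 := by
  ext a b
  simp only [tensor, Matrix.of_apply, Matrix.one_apply, Finset.prod_ite_zero, Finset.prod_const_one]
  simp [funext_iff]

theorem tensor_conjTranspose (A : Fin n → Matrix (Fin 2) (Fin 2) ℂ) :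
    (tensor A)ᴴ = tensor fun i => (A i)ᴴ := by
  ext a b
  simp [tensor, Matrix.conjTranspose_apply]

/-- Conjugation by a one-qubit gate and anticommutation at one position both change a tensor product
by a scalar in a single factor. -/
theorem tensor_eq_smul (A B : Fin n → Matrix (Fin 2) (Fin 2) ℂ) (c : Fin n) (ε : ℂ)
    (hc : A c = ε • B c) (h : ∀ i, i ≠ c → A i = B i) : tensor A = ε • tensor B := by
  ext a b
  simp only [tensor, Matrix.of_apply, Matrix.smul_apply, smul_eq_mul]
  rw [← Finset.mul_prod_erase _ _ (Finset.mem_univ c),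
    ← Finset.mul_prod_erase _ _ (Finset.mem_univ c), hc, ← mul_assoc, Matrix.smul_apply,
    smul_eq_mul]
  congr 1
  exact Finset.prod_congr rfl fun i hi => by rw [h i (Finset.ne_of_mem_erase hi)]

theorem Pauli.mat_mul_self (P : Pauli) : P.mat * P.mat = 1 := by
  cases P <;> ext i j <;> fin_cases i <;> fin_cases j <;> simp [Pauli.mat]

theorem PauliString.mat_mul_self (P : PauliString n) : P.mat * P.mat = 1 := by
  simp [PauliString.mat, tensor_mul, Pauli.mat_mul_self, tensor_one]

theorem PauliString.mat_one : PauliString.mat (fun _ : Fin n => Pauli.I) = 1 := by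
  simp [PauliString.mat, Pauli.mat, tensor_one]

theorem SignedPauli.mat_mul_self (P : SignedPauli n) : P.mat * P.mat = 1 := by
  rcases P with ⟨s, P⟩
  cases s <;> simp [SignedPauli.mat, PauliString.mat_mul_self]

/-! ### Conjugation of Pauli operators by gates -/

/-- The Pauli label with given `X`-bit and `Z`-bit. -/
def Pauli.ofBits : Bool → Bool → Pauli
  | false, false => I
  | true, false => X
  | true, true => Y
  | false, true => Z

/-- The Pauli label of `H P H`. -/
def Pauli.had : Pauli → Pauli
  | I => I
  | X => Z
  | Y => Y
  | Z => X

/-- The Pauli label of `R† P R` for the phase gate `R`. -/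
def Pauli.phase : Pauli → Pauli
  | I => I
  | X => Y
  | Y => X
  | Z => Z

/-- The `X`-bit as a truth value. -/
def Pauli.hasX (P : Pauli) : Bool := P.xBit == 1

/-- The `Z`-bit as a truth value. -/
def Pauli.hasZ (P : Pauli) : Bool := P.zBit == 1

/-- The signed Pauli operator `U† P U` for the gate `U`. -/
def Gate.conj : Gate n → SignedPauli n → SignedPauli n
  | .had i, P => (P.1 ^^ decide (P.2 i = .Y), Function.update P.2 i (P.2 i).had)
  | .phase i, P => (P.1 ^^ decide (P.2 i = .X), Function.update P.2 i (P.2 i).phase)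
  | .cnot i j _, P =>
    (P.1 ^^ ((P.2 i).hasX && (P.2 j).hasZ && ((P.2 j).hasX == (P.2 i).hasZ)),
      Function.update (Function.update P.2 i
        (.ofBits (P.2 i).hasX ((P.2 i).hasZ ^^ (P.2 j).hasZ))) j
        (.ofBits ((P.2 j).hasX ^^ (P.2 i).hasX) (P.2 j).hasZ))

/-- The sign of a truth value, `true` for minus. -/
noncomputable def sgn (b : Bool) : ℂ := if b then -1 else 1

theorem SignedPauli.mat_eq (P : SignedPauli n) : P.mat = sgn P.1 • P.2.mat := rfl

theorem sgn_xor (a b : Bool) : sgn (a ^^ b) = sgn a * sgn b := by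
  cases a <;> cases b <;> simp [sgn]

theorem sgn_mul_self (a : Bool) : sgn a * sgn a = 1 := by
  cases a <;> simp [sgn]

theorem tensor_single_mul_conj (A : Matrix (Fin 2) (Fin 2) ℂ) (i : Fin n) (P : PauliString n)
    (Q : Pauli) (b : Bool) (h : A * Q.mat = sgn b • ((P i).mat * A)) :
    tensor (Function.update (fun _ => 1) i A) * PauliString.mat (Function.update P i Q)
      = sgn b • (P.mat * tensor (Function.update (fun _ => 1) i A)) := by
  rw [PauliString.mat, PauliString.mat, tensor_mul, tensor_mul]
  refine tensor_eq_smul _ _ i _ (by simpa using h) fun j hj => ?_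
  simp [Function.update_of_ne hj]

theorem Gate.mat_cnot_mul (i j : Fin n) (h : i ≠ j) (M : Op n) (a b : Bits n) :
    ((Gate.cnot i j h).mat * M) a b = M (Function.update a j (a j + a i)) b := by
  have key : ∀ d : Bits n, a = Function.update d j (d j + d i) ↔
      d = Function.update a j (a j + a i) := by
    have two : ∀ x y : Fin 2, x + y + y = x := by decide
    intro d
    constructor <;> rintro rfl <;> ext l <;> by_cases hl : l = j <;>
      simp [hl, h, two]
  simp [Matrix.mul_apply, Gate.mat, key]

theorem Gate.mul_mat_cnot (i j : Fin n) (h : i ≠ j) (M : Op n) (a b : Bits n) :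
    (M * (Gate.cnot i j h).mat) a b = M a (Function.update b j (b j + b i)) := by
  simp [Matrix.mul_apply, Gate.mat]

/-- CNOT permutes the basis, so conjugating by it only relabels matrix entries, and the sign rule is
a finite check on two qubits. -/
theorem Pauli.cnot_entry (P Q : Pauli) (a b c d : Fin 2) :
    sgn (P.hasX && Q.hasZ && (Q.hasX == P.hasZ)) *
      ((Pauli.ofBits P.hasX (P.hasZ ^^ Q.hasZ)).mat a c *
        (Pauli.ofBits (Q.hasX ^^ P.hasX) Q.hasZ).mat (b + a) d) =
      P.mat a c * Q.mat b (d + c) := by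
  cases P <;> cases Q <;> fin_cases a <;> fin_cases b <;> fin_cases c <;> fin_cases d <;>
    simp [Pauli.mat, Matrix.one_fin_two, Pauli.ofBits, Pauli.hasX, Pauli.hasZ, Pauli.xBit, Pauli.zBit, sgn]

/-- The form `U (U† P U) = P U` needs no unitarity and is the one used on codewords. -/
theorem Gate.mat_mul_conj (G : Gate n) (P : SignedPauli n) :
    G.mat * (G.conj P).mat = P.mat * G.mat := by
  rcases P with ⟨s, P⟩
  cases G with
  | had i =>
    simp only [Gate.conj, SignedPauli.mat_eq, Gate.mat, sgn_xor, Matrix.mul_smul, Matrix.smul_mul]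
    rw [tensor_single_mul_conj _ _ _ _ (decide (P i = .Y)), smul_smul, mul_assoc, sgn_mul_self, mul_one]
    cases P i <;> ext a b <;> fin_cases a <;> fin_cases b <;>
      simp [Pauli.had, Pauli.mat, sgn, Matrix.mul_apply, mul_comm]
  | phase i =>
    simp only [Gate.conj, SignedPauli.mat_eq, Gate.mat, sgn_xor, Matrix.mul_smul, Matrix.smul_mul]
    rw [tensor_single_mul_conj _ _ _ _ (decide (P i = .X)), smul_smul, mul_assoc, sgn_mul_self, mul_one]
    cases P i <;> ext a b <;> fin_cases a <;> fin_cases b <;>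
      simp [Pauli.phase, Pauli.mat, sgn, Matrix.mul_apply]
  | cnot i j h =>
    simp only [Gate.conj, SignedPauli.mat_eq, sgn_xor, Matrix.mul_smul, Matrix.smul_mul, mul_smul]
    congr 1
    ext a b
    rw [Matrix.smul_apply, Gate.mat_cnot_mul, Gate.mul_mat_cnot]
    simp only [PauliString.mat, tensor, Matrix.of_apply, smul_eq_mul]
    have hj : j ∈ Finset.univ.erase i := by simp [h.symm]
    simp only [← Finset.mul_prod_erase _ _ (Finset.mem_univ i), ← Finset.mul_prod_erase _ _ hj]
    simp only [← mul_assoc]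
    congr 1
    · have := Pauli.cnot_entry (P i) (P j) (a i) (a j) (b i) (b j)
      simpa [h, mul_assoc] using this
    · refine Finset.prod_congr rfl fun l hl => ?_
      have h1 : l ≠ j := Finset.ne_of_mem_erase hl
      have h2 : l ≠ i := Finset.ne_of_mem_erase (Finset.mem_of_mem_erase hl)
      simp [h1, h2]

/-- Conjugation by a circuit. -/
def Circuit.conj (c : Circuit n) (P : SignedPauli n) : SignedPauli n :=
  c.foldl (fun P G => G.conj P) P

/-- A circuit denotes `U_1 ⋯ U_m`, and `U† P U` conjugates by `U_1` first. Processing the current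
generators by one more gate therefore appends that gate to the list. -/
theorem Circuit.conj_append (c d : Circuit n) (P : SignedPauli n) :
    Circuit.conj (c ++ d) P = d.conj (c.conj P) := by
  simp [Circuit.conj]

theorem Circuit.mat_append (c d : Circuit n) : Circuit.mat (c ++ d) = c.mat * d.mat := by
  simp [Circuit.mat]

theorem Circuit.mat_cons (G : Gate n) (c : Circuit n) : Circuit.mat (G :: c) = G.mat * c.mat := by
  simp [Circuit.mat]

theorem Circuit.mat_mul_conj (c : Circuit n) (P : SignedPauli n) :
    c.mat * (c.conj P).mat = P.mat * c.mat := by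
  induction c generalizing P with
  | nil => simp [Circuit.mat, Circuit.conj]
  | cons G c ih =>
    change Circuit.mat (G :: c) * (Circuit.conj c (G.conj P)).mat = _
    rw [Circuit.mat_cons, mul_assoc, ih, ← mul_assoc, Gate.mat_mul_conj, mul_assoc]

/-! ### Unitarity -/

theorem tensor_single_mul (i : Fin n) (A B : Matrix (Fin 2) (Fin 2) ℂ) :
    tensor (Function.update (fun _ => 1) i A) * tensor (Function.update (fun _ => 1) i B)
      = tensor (Function.update (fun _ => 1) i (A * B)) := by
  rw [tensor_mul]
  congr 1
  ext1 j
  by_cases h : j = i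
  · subst h; simp
  · simp [h]

theorem tensor_single_one (i : Fin n) :
    tensor (Function.update (fun _ => 1) i (1 : Matrix (Fin 2) (Fin 2) ℂ)) = 1 := by
  rw [← tensor_one, Function.update_eq_self_iff.2 rfl]

theorem inv_sqrt_two_mul_self :
    (((Real.sqrt 2 : ℝ) : ℂ)⁻¹) * (((Real.sqrt 2 : ℝ) : ℂ)⁻¹) = 1 / 2 := by
  rw [← mul_inv, ← Complex.ofReal_mul, Real.mul_self_sqrt (by norm_num)]
  norm_num

theorem hadamard_mul_self :
    ((((Real.sqrt 2 : ℝ) : ℂ)⁻¹) • !![1, 1; 1, -1] : Matrix (Fin 2) (Fin 2) ℂ) *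
      ((((Real.sqrt 2 : ℝ) : ℂ)⁻¹) • !![1, 1; 1, -1]) = 1 := by
  rw [Matrix.smul_mul, Matrix.mul_smul, smul_smul, inv_sqrt_two_mul_self]
  ext a b
  fin_cases a <;> fin_cases b <;> norm_num

theorem Gate.inv_mat_mul (G : Gate n) : Circuit.mat G.inv * G.mat = 1 := by
  cases G with
  | had i =>
    simp only [Circuit.mat, Gate.inv, Gate.mat, List.map_cons, List.map_nil, List.prod_cons,
      List.prod_nil, mul_one, tensor_single_mul, hadamard_mul_self, tensor_single_one]
  | phase i =>
    simp only [Circuit.mat, Gate.inv, Gate.mat, List.map_cons, List.map_nil, List.prod_cons,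
      List.prod_nil, mul_one, tensor_single_mul]
    rw [← tensor_single_one i]
    congr 2
    ext a b
    fin_cases a <;> fin_cases b <;> simp
  | cnot i j h =>
    ext a b
    simp only [Circuit.mat, Gate.inv, List.map_cons, List.map_nil, List.prod_cons,
      List.prod_nil, mul_one]
    rw [Gate.mat_cnot_mul]
    simp [Gate.mat, Matrix.one_apply]
    congr 1
    rw [eq_iff_iff]
    constructor
    · intro e
      -- The control bit is unchanged by the CNOT, so equality there lets the two added bits cancel
      -- on the target.
      have hi := congrFun e i
      ext l
      have hl := congrFun e l
      by_cases hlj : l = j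
      · subst hlj; simp_all
      · simp_all
    · rintro rfl; rfl

theorem Gate.mat_conjTranspose_mul (G : Gate n) : G.matᴴ * G.mat = 1 := by
  cases G with
  | had i =>
    have : ((Gate.had i).mat)ᴴ = (Gate.had i).mat := by
      rw [Gate.mat, tensor_conjTranspose]
      congr 1
      ext1 j
      by_cases h : j = i
      · subst h
        ext a b
        fin_cases a <;> fin_cases b <;> simp
      · simp [h]
    rw [this]
    simpa [Circuit.mat, Gate.inv] using Gate.inv_mat_mul (Gate.had i)
  | phase i =>
    rw [Gate.mat, tensor_conjTranspose, tensor_mul, ← tensor_one]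
    congr 1
    ext1 j
    by_cases h : j = i
    · subst h
      ext a b
      fin_cases a <;> fin_cases b <;> simp [Matrix.mul_apply]
    · simp [h]
  | cnot i j h =>
    have : ((Gate.cnot i j h).mat)ᴴ = (Gate.cnot i j h).mat := by
      have two : ∀ x y : Fin 2, x + y + y = x := by decide
      ext a b
      simp only [Gate.mat, Matrix.conjTranspose_apply, Matrix.of_apply, RCLike.star_def]
      have key : b = Function.update a j (a j + a i) ↔ a = Function.update b j (b j + b i) := by
        constructor <;> rintro rfl <;> ext l <;> by_cases hl : l = j <;> simp [hl, h, two]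
      simp [key, apply_ite]
    rw [this]
    simpa [Circuit.mat, Gate.inv] using Gate.inv_mat_mul (Gate.cnot i j h)

theorem Circuit.mat_conjTranspose_mul (c : Circuit n) : c.matᴴ * c.mat = 1 := by
  induction c with
  | nil => simp [Circuit.mat]
  | cons G c ih =>
    rw [Circuit.mat_cons, Matrix.conjTranspose_mul, mul_assoc, ← mul_assoc _ G.mat,
      Gate.mat_conjTranspose_mul, one_mul, ih]

theorem Circuit.inv_mat_mul (c : Circuit n) : c.inv.mat * c.mat = 1 := by
  induction c with
  | nil => simp [Circuit.mat, Circuit.inv]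
  | cons G c ih =>
    have : Circuit.inv (G :: c) = Circuit.inv c ++ G.inv := by simp [Circuit.inv]
    rw [this, Circuit.mat_append, Circuit.mat_cons, mul_assoc, ← mul_assoc _ G.mat,
      Gate.inv_mat_mul, one_mul, ih]

theorem Circuit.inv_mat (c : Circuit n) : c.inv.mat = c.matᴴ :=
  left_inv_eq_right_inv c.inv_mat_mul (mul_eq_one_comm.1 c.mat_conjTranspose_mul)

theorem Gate.inv_length_le (G : Gate n) : G.inv.length ≤ 3 := by
  cases G <;> simp [Gate.inv]

theorem Circuit.inv_length_le (c : Circuit n) : c.inv.length ≤ 3 * c.length := by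
  induction c with
  | nil => simp [Circuit.inv]
  | cons G c ih =>
    have : Circuit.inv (G :: c) = Circuit.inv c ++ G.inv := by simp [Circuit.inv]
    rw [this, List.length_append, List.length_cons]
    have := G.inv_length_le
    omega

/-! ### Distinct signed Pauli operators have distinct matrices -/

theorem trace_tensor (A : Fin n → Matrix (Fin 2) (Fin 2) ℂ) :
    (tensor A).trace = ∏ i, (A i).trace := by
  simp only [Matrix.trace, tensor, Matrix.diag_apply, Matrix.of_apply]
  rw [Finset.prod_univ_sum]
  simp

theorem Pauli.eq_of_trace_ne_zero (P Q : Pauli) (h : (P.mat * Q.mat).trace ≠ 0) : P = Q := by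
  cases P <;> cases Q <;> first | rfl | (exact absurd (by simp [Pauli.mat, Matrix.trace]) h)

/-- Distinct Pauli strings are orthogonal for the trace form, whereas the product of two equal
operators is `1`, with nonzero trace. -/
theorem SignedPauli.mat_injective : Function.Injective (SignedPauli.mat (n := n)) := by
  rintro ⟨a, P⟩ ⟨b, Q⟩ h
  have hsgn : ∀ x : Bool, sgn x ≠ 0 := fun x => by cases x <;> simp [sgn]
  have hPQ : P = Q := by
    have h1 : (SignedPauli.mat (a, P) * SignedPauli.mat (b, Q)).trace ≠ 0 := by
      rw [h, SignedPauli.mat_mul_self, Matrix.trace_one]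
      simp
    simp only [SignedPauli.mat_eq, Matrix.smul_mul, Matrix.mul_smul, Matrix.trace_smul,
      PauliString.mat, tensor_mul, trace_tensor, smul_eq_mul] at h1
    have h2 := Finset.prod_ne_zero_iff.1 (right_ne_zero_of_mul (right_ne_zero_of_mul h1))
    exact funext fun i => Pauli.eq_of_trace_ne_zero _ _ (h2 i (Finset.mem_univ i))
  subst hPQ
  have hP : PauliString.mat P ≠ 0 := fun h0 => by
    simpa [h0] using PauliString.mat_mul_self P
  have := smul_left_injective ℂ hP h
  cases a <;> cases b <;> simp_all [sgn] <;> norm_num at this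

theorem SignedPauli.mat_neg_one : SignedPauli.mat ((true, fun _ => Pauli.I) : SignedPauli n) = -1 := by
  simp [SignedPauli.mat, PauliString.mat_one]

/-! ### Strings of `Z` operators -/

/-- The string with `Z` on the qubits in `J` and the identity elsewhere. -/
def zString (J : Finset (Fin n)) : PauliString n := fun i => if i ∈ J then Pauli.Z else Pauli.I

theorem zString_mul (J K : Finset (Fin n)) :
    (zString J).mat * (zString K).mat = (zString (symmDiff J K)).mat := by
  rw [PauliString.mat, PauliString.mat, PauliString.mat, tensor_mul]
  congr 1
  ext1 i
  by_cases hJ : i ∈ J <;> by_cases hK : i ∈ K <;>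
    simp [zString, hJ, hK, Finset.mem_symmDiff, Pauli.mat, Matrix.one_fin_two]

theorem zString_empty : (zString (∅ : Finset (Fin n))).mat = 1 := by
  rw [show zString (∅ : Finset (Fin n)) = fun _ => Pauli.I from funext fun i => by simp [zString]]
  exact PauliString.mat_one

theorem zString_injective : Function.Injective (zString (n := n)) := by
  intro J K h
  ext i
  have := congrFun h i
  by_cases hJ : i ∈ J <;> by_cases hK : i ∈ K <;> simp_all [zString]

theorem eq_zString (P : PauliString n) (h : ∀ l, P l = Pauli.I ∨ P l = Pauli.Z) :
    P = zString (Finset.univ.filter fun l => P l = Pauli.Z) := by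
  ext1 l
  rcases h l with h | h <;> simp [zString, h]

/-! ### Commuting involutions -/

/-- `T` commuting involutions generate at most `2 ^ |T|` elements. -/
theorem closure_ncard_le {M : Type*} [Monoid M] (T : Finset M)
    (hc : ∀ a ∈ T, ∀ b ∈ T, a * b = b * a) (hs : ∀ a ∈ T, a * a = 1) :
    (Submonoid.closure (T : Set M) : Set M).Finite ∧
      (Submonoid.closure (T : Set M) : Set M).ncard ≤ 2 ^ T.card := by
  classical
  induction T using Finset.induction_on with
  | empty => simp
  | insert a T ha ih =>
    obtain ⟨hf, hn⟩ := ih (fun x hx y hy => hc x (by simp [hx]) y (by simp [hy]))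
      (fun x hx => hs x (by simp [hx]))
    have haa : a * a = 1 := hs a (by simp)
    have hcomm : ∀ y ∈ Submonoid.closure (T : Set M), a * y = y * a := by
      intro y hy
      induction hy using Submonoid.closure_induction with
      | mem x hx => exact hc a (by simp) x (by simp [Finset.mem_coe.1 hx])
      | one => simp
      | mul x y _ _ hx hy => rw [← mul_assoc, hx, mul_assoc, hy, mul_assoc]
    -- A new commuting involution at most doubles the monoid: it adds only the translate by `a`.
    have hsub : (Submonoid.closure ((insert a T : Finset M) : Set M) : Set M) ⊆
        (Submonoid.closure (T : Set M) : Set M) ∪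
          (fun y => a * y) '' (Submonoid.closure (T : Set M) : Set M) := by
      intro x hx
      induction hx using Submonoid.closure_induction with
      | mem x hx =>
        rcases Finset.mem_insert.1 (Finset.mem_coe.1 hx) with rfl | hx
        · exact Or.inr ⟨1, Submonoid.one_mem _, mul_one _⟩
        · exact Or.inl (Submonoid.subset_closure hx)
      | one => exact Or.inl (Submonoid.one_mem _)
      | mul x y _ _ hx hy =>
        rcases hx with hx | ⟨x, hx, rfl⟩ <;> rcases hy with hy | ⟨y, hy, rfl⟩
        · exact Or.inl (Submonoid.mul_mem _ hx hy)
        · refine Or.inr ⟨x * y, Submonoid.mul_mem _ hx hy, ?_⟩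
          simp only [← mul_assoc, hcomm x hx]
        · exact Or.inr ⟨x * y, Submonoid.mul_mem _ hx hy, (mul_assoc _ _ _).symm⟩
        · refine Or.inl ?_
          have : a * x * (a * y) = x * y := by
            rw [hcomm x hx, mul_assoc, ← mul_assoc a a, haa, one_mul]
          simp only [this]
          exact Submonoid.mul_mem _ hx hy
    have hfi := hf.image (fun y => a * y)
    refine ⟨(hf.union hfi).subset hsub, ?_⟩
    calc _ ≤ _ := Set.ncard_le_ncard hsub (hf.union hfi)
      _ ≤ _ := Set.ncard_union_le _ _
      _ ≤ 2 ^ T.card + 2 ^ T.card := add_le_add hn ((Set.ncard_image_le hf).trans hn)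
      _ = _ := by rw [Finset.card_insert_of_notMem ha, pow_succ]; ring

/-- The operators `h r` commute, they are independent, and they do not generate `-1`. -/
structure IndepGenerators (h : Fin m → SignedPauli n) : Prop where
  comm : ∀ r s, (h r).mat * (h s).mat = (h s).mat * (h r).mat
  neg_one : (-1 : Op n) ∉ Submonoid.closure (Set.range fun r => (h r).mat)
  card : 2 ^ m ≤ (Submonoid.closure (Set.range fun r => (h r).mat) : Set (Op n)).ncard

/-- Injectivity of `SignedPauli.mat` transfers the absence of `-I` and the order `2 ^ (n - k)` from
`S` to the generated matrices. -/
theorem IsStabilizer.indepGenerators {k : ℕ} {S : Finset (SignedPauli n)} (hS : IsStabilizer k S)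
    {g : Fin (n - k) → SignedPauli n} (hg : Generates g S) : IndepGenerators g := by
  obtain ⟨-, hcomm, hneg, hcard⟩ := hS
  have hmem : ∀ r, g r ∈ S := fun r => by
    have : (g r).mat ∈ SignedPauli.mat '' (S : Set (SignedPauli n)) := by
      rw [hg]; exact Submonoid.subset_closure ⟨r, rfl⟩
    obtain ⟨P, hP, e⟩ := this
    rwa [← SignedPauli.mat_injective e]
  refine ⟨fun r s => hcomm _ (hmem r) _ (hmem s), fun h => hneg ?_, ?_⟩
  · rw [← SetLike.mem_coe, ← hg, ← SignedPauli.mat_neg_one] at h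
    obtain ⟨P, hP, e⟩ := h
    rwa [← SignedPauli.mat_injective e]
  · rw [← hg, Set.ncard_image_of_injective _ SignedPauli.mat_injective, Set.ncard_coe_finset, hcard]

/-- `A ↦ U A U†` is an injective monoid homomorphism that fixes `-1` and carries the conjugated
generators back to the original ones. -/
theorem IndepGenerators.conj {g : Fin m → SignedPauli n} (hg : IndepGenerators g)
    (c : Circuit n) : IndepGenerators fun r => c.conj (g r) := by
  have hU := c.mat_conjTranspose_mul
  have hU' := mul_eq_one_comm.1 hU
  let φ : Op n →* Op n :=
    { toFun := fun M => c.mat * M * c.matᴴ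
      map_one' := by rw [mul_one, hU']
      map_mul' := fun A B => by
        rw [show c.mat * A * c.matᴴ * (c.mat * B * c.matᴴ)
          = c.mat * A * (c.matᴴ * c.mat) * B * c.matᴴ by simp only [mul_assoc], hU]
        simp only [mul_assoc, mul_one] }
  have hφ : ∀ P : SignedPauli n, φ (c.conj P).mat = P.mat := fun P => by
    change c.mat * _ * c.matᴴ = _
    rw [Circuit.mat_mul_conj, mul_assoc, hU', mul_one]
  have hinj : Function.Injective φ := fun A B h => by
    have h' : c.mat * A * c.matᴴ = c.mat * B * c.matᴴ := h
    have := congrArg (fun M => c.matᴴ * M * c.mat) h'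
    simpa only [mul_assoc, hU, mul_one, ← mul_assoc c.matᴴ c.mat, one_mul] using this
  have hcl : (Submonoid.closure (Set.range fun r => (g r).mat)) =
      (Submonoid.closure (Set.range fun r => (c.conj (g r)).mat)).map φ := by
    rw [MonoidHom.map_mclosure, ← Set.range_comp]
    congr 2
    ext1 r
    exact (hφ _).symm
  refine ⟨fun r s => hinj ?_, fun h => hg.neg_one ?_, ?_⟩
  · rw [map_mul, map_mul, hφ, hφ, hg.comm]
  · rw [hcl]
    refine ⟨-1, h, ?_⟩
    change c.mat * (-1) * c.matᴴ = -1
    rw [mul_neg, mul_one, neg_mul, hU']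
  · have := hg.card
    rwa [hcl, Submonoid.coe_map, Set.ncard_image_of_injective _ hinj] at this

/-- The string is of `Z` type with sign `+`, acts by `Z` on qubit `r`, and acts trivially on all
later qubits. -/
structure Reduced (r : ℕ) (P : SignedPauli n) : Prop where
  sign : P.1 = false
  diag : ∀ l : Fin n, (l : ℕ) = r → P.2 l = Pauli.Z
  lower : ∀ l : Fin n, (l : ℕ) < r → P.2 l = Pauli.I ∨ P.2 l = Pauli.Z
  upper : ∀ l : Fin n, r < l → P.2 l = Pauli.I

theorem Reduced.isZ {r : ℕ} {P : SignedPauli n} (h : Reduced r P) (l : Fin n) :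
    P.2 l = Pauli.I ∨ P.2 l = Pauli.Z := by
  rcases lt_trichotomy (l : ℕ) r with hl | hl | hl
  · exact h.lower l hl
  · exact Or.inr (h.diag l hl)
  · exact Or.inl (h.upper l hl)

theorem anticomm_of_single (P Q : PauliString n) (j : Fin n)
    (h : ∀ l, l ≠ j → (P l).mat * (Q l).mat = (Q l).mat * (P l).mat)
    (hj : (P j).mat * (Q j).mat = -((Q j).mat * (P j).mat)) :
    P.mat * Q.mat = -(Q.mat * P.mat) := by
  rw [PauliString.mat, PauliString.mat, tensor_mul, tensor_mul, ← neg_one_smul ℂ]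
  exact tensor_eq_smul _ _ j _ (by simpa using hj) h

/-- An operator that commutes with reduced operators on the qubits before `i` has no `X`-part
there. -/
theorem lower_of_comm {P : SignedPauli n} {i : ℕ} (q : Fin n → SignedPauli n)
    (hq : ∀ r : Fin n, (r : ℕ) < i → Reduced r (q r))
    (hc : ∀ r : Fin n, (r : ℕ) < i → P.mat * (q r).mat = (q r).mat * P.mat) :
    ∀ l : Fin n, (l : ℕ) < i → P.2 l = Pauli.I ∨ P.2 l = Pauli.Z := by
  rintro ⟨l, hl⟩
  induction l using Nat.strong_induction_on with
  | _ l ih =>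
    intro hli
    simp only at hli
    by_contra hcon
    have hR := hq ⟨l, hl⟩ hli
    have hdiag := hR.diag ⟨l, hl⟩ rfl
    -- Before qubit `l` both operators are of `Z` type, by induction, and after it the reduced one
    -- is trivial. An `X` or `Y` against `Z` at `l` is then the only anticommuting position.
    have hanti : P.2.mat * (q ⟨l, hl⟩).2.mat = -((q ⟨l, hl⟩).2.mat * P.2.mat) := by
      refine anticomm_of_single _ _ ⟨l, hl⟩ (fun s hs => ?_) ?_
      · rcases lt_or_gt_of_ne (fun e => hs (Fin.ext e) : (s : ℕ) ≠ l) with h | h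
        · have h1 := ih s h s.2 (h.trans hli)
          have h2 := hR.lower s h
          rcases h1 with h1 | h1 <;> rcases h2 with h2 | h2 <;> simp [h1, h2, Pauli.mat]
        · rw [hR.upper s h]; simp [Pauli.mat]
      · rw [hdiag]
        cases hP : P.2 ⟨l, hl⟩
        · exact absurd (Or.inl hP) hcon
        · simp [Pauli.mat]
        · simp [Pauli.mat]
        · exact absurd (Or.inr hP) hcon
    have hcomm := hc ⟨l, hl⟩ hli
    have h1 : P.mat * (q ⟨l, hl⟩).mat = -((q ⟨l, hl⟩).mat * P.mat) := by
      simp only [SignedPauli.mat_eq, Matrix.smul_mul, Matrix.mul_smul, hanti, smul_neg,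
        smul_smul, mul_comm]
    rw [hcomm] at h1
    -- Commuting and anticommuting forces the product to vanish, which is impossible for two
    -- involutions.
    have h2 : (q ⟨l, hl⟩).mat * P.mat = 0 := by
      rw [eq_neg_iff_add_eq_zero, ← two_smul ℂ] at h1
      exact (smul_eq_zero.1 h1).resolve_left two_ne_zero
    have h3 : (q ⟨l, hl⟩).mat * ((q ⟨l, hl⟩).mat * P.mat) * P.mat = 0 := by rw [h2]; simp
    rw [← mul_assoc, SignedPauli.mat_mul_self, one_mul, SignedPauli.mat_mul_self] at h3
    exact one_ne_zero h3

/-- Reduced operators generate all strings of `Z` type on the qubits before `i`. -/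
theorem zString_mem_closure {i : ℕ} (q : Fin n → SignedPauli n)
    (hq : ∀ r : Fin n, (r : ℕ) < i → Reduced r (q r)) :
    ∀ d, d ≤ i → ∀ J : Finset (Fin n), (∀ l ∈ J, (l : ℕ) < d) →
      (zString J).mat ∈ Submonoid.closure {M | ∃ r : Fin n, (r : ℕ) < i ∧ (q r).mat = M} := by
  intro d
  induction d with
  | zero =>
    intro _ J hJ
    have : J = ∅ := Finset.eq_empty_of_forall_notMem fun l hl => by simpa using hJ l hl
    rw [this, zString_empty]
    exact Submonoid.one_mem _
  | succ d ih =>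
    intro hd J hJ
    by_cases h : ∃ l ∈ J, (l : ℕ) = d
    -- The rows are triangular: multiplying by the row with last qubit `l` removes `l` from the
    -- support and changes only earlier qubits.
    · obtain ⟨l, hl, rfl⟩ := h
      have hR := hq l (by omega)
      set K := Finset.univ.filter fun s => (q l).2 s = Pauli.Z with hK
      have hql : (q l).mat = (zString K).mat := by
        rw [SignedPauli.mat_eq, hR.sign, ← eq_zString _ hR.isZ]
        simp [sgn]
      have hmem := ih (by omega) (symmDiff J K) (fun s hs => by
        have hne : s ≠ l := by
          rintro rfl
          simp [Finset.mem_symmDiff, hK, hl, hR.diag s rfl] at hs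
        have hle : (s : ℕ) ≤ l := by
          rcases Finset.mem_symmDiff.1 hs with h | h
          · have := hJ s h.1; omega
          · by_contra hlt
            have := hR.upper s (by omega)
            simp [hK, this] at h
        have : (s : ℕ) ≠ l := fun e => hne (Fin.ext e)
        omega)
      have h2 : (zString J).mat = (zString (symmDiff J K)).mat * (q l).mat := by
        rw [hql, zString_mul, symmDiff_assoc, symmDiff_self, symmDiff_bot]
      rw [h2]
      exact Submonoid.mul_mem _ hmem (Submonoid.subset_closure ⟨l, by omega, rfl⟩)
    · push Not at h
      exact ih (by omega) J fun l hl => by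
        have := hJ l hl; have := h l hl; omega

/-- Once the rows before `i` are reduced and row `i` acts trivially after qubit `i`, the first
part of row `i` is of `Z` type, and row `i` acts nontrivially on qubit `i`. -/
theorem IndepGenerators.row_spec {h : Fin m → SignedPauli n} (hh : IndepGenerators h)
    (hmn : m ≤ n) (i : Fin m) (hred : ∀ r : Fin m, r < i → Reduced r (h r))
    (hup : ∀ l : Fin n, (i : ℕ) < l → (h i).2 l = Pauli.I) :
    (∀ l : Fin n, (l : ℕ) < i → (h i).2 l = Pauli.I ∨ (h i).2 l = Pauli.Z) ∧
      (h i).2 (Fin.castLE hmn i) ≠ Pauli.I := by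
  classical
  -- The default value `h i` only makes `q` total; `q` is evaluated at rows before `i` alone.
  let q : Fin n → SignedPauli n := fun r => if hr : (r : ℕ) < m then h ⟨r, hr⟩ else h i
  have hqv : ∀ r : Fin n, (r : ℕ) < i → ∃ s : Fin m, (s : ℕ) = r ∧ q r = h s := fun r hr =>
    ⟨⟨r, hr.trans i.2⟩, rfl, by simp [q, hr.trans i.2]⟩
  have hq : ∀ r : Fin n, (r : ℕ) < i → Reduced r (q r) := fun r hr => by
    obtain ⟨s, hs, e⟩ := hqv r hr
    rw [e, ← hs]
    exact hred s (by rw [Fin.lt_def]; omega)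
  have hlow := lower_of_comm (P := h i) (i := i) q hq fun r hr => by
    obtain ⟨s, hs, e⟩ := hqv r hr
    rw [e, hh.comm]
  refine ⟨hlow, fun hI => ?_⟩
  have hZ : ∀ l, (h i).2 l = Pauli.I ∨ (h i).2 l = Pauli.Z := fun l => by
    rcases lt_trichotomy (l : ℕ) i with hl | hl | hl
    · exact hlow l hl
    · exact Or.inl (by rwa [show l = Fin.castLE hmn i from Fin.ext hl])
    · exact Or.inl (hup l hl)
  have hmem := zString_mem_closure q hq i le_rfl
    (Finset.univ.filter fun l => (h i).2 l = Pauli.Z) (fun l hl => by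
      by_contra hlt
      simp only [Finset.mem_filter, Finset.mem_univ, true_and] at hl
      rcases (not_lt.1 hlt).eq_or_lt with e | e
      · rw [show l = Fin.castLE hmn i from Fin.ext e.symm, hI] at hl
        cases hl
      · rw [hup l e] at hl
        cases hl)
  rw [← eq_zString _ hZ] at hmem
  set T : Finset (Op n) := (Finset.univ.erase i).image fun r => (h r).mat with hT
  have hsub : {M | ∃ r : Fin n, (r : ℕ) < i ∧ (q r).mat = M} ⊆ (T : Set (Op n)) := by
    rintro M ⟨r, hr, rfl⟩
    obtain ⟨s, hs, e⟩ := hqv r hr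
    have : s ≠ i := by rintro rfl; omega
    simp only [hT, Finset.coe_image, e]
    exact ⟨s, by simpa using this, rfl⟩
  have hmemT := Submonoid.closure_mono hsub hmem
  have hTall : (T : Set (Op n)) ⊆ Set.range fun r => (h r).mat := by
    simp only [hT, Finset.coe_image]
    exact Set.image_subset_range _ _
  -- With sign `+`, row `i` is redundant and the other `m - 1` involutions generate at most `2 ^ (m
  -- - 1)` elements. With sign `-`, row `i` times the same string with sign `+` is `-1`.
  cases hs : (h i).1
  · have hi : (h i).mat ∈ Submonoid.closure (T : Set (Op n)) := by
      rw [SignedPauli.mat_eq, hs]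
      simpa [sgn] using hmemT
    have heq : Submonoid.closure (Set.range fun r => (h r).mat) ≤ Submonoid.closure (T : Set (Op n)) := by
      rw [Submonoid.closure_le]
      rintro _ ⟨r, rfl⟩
      by_cases hr : r = i
      · subst hr; exact hi
      · exact Submonoid.subset_closure (by
          simp only [hT, Finset.coe_image]
          exact ⟨r, by simpa using hr, rfl⟩)
    obtain ⟨hf, hn⟩ := closure_ncard_le T (by
        simp only [hT, Finset.mem_image]
        rintro _ ⟨a, -, rfl⟩ _ ⟨b, -, rfl⟩
        exact hh.comm a b) (by
        simp only [hT, Finset.mem_image]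
        rintro _ ⟨a, -, rfl⟩
        exact SignedPauli.mat_mul_self _)
    have h1 := (hh.card.trans (Set.ncard_le_ncard heq hf)).trans hn
    have h2 : T.card ≤ m - 1 := by
      refine Finset.card_image_le.trans ?_
      rw [Finset.card_erase_of_mem (Finset.mem_univ i), Finset.card_univ, Fintype.card_fin]
    have h3 := (Nat.pow_le_pow_iff_right (by norm_num)).1 h1
    have := i.2
    omega
  · refine hh.neg_one ?_
    have hm := Submonoid.mul_mem _ (Submonoid.subset_closure ⟨i, rfl⟩ :
      (h i).mat ∈ Submonoid.closure (Set.range fun r => (h r).mat))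
      (Submonoid.closure_mono hTall hmemT)
    rwa [SignedPauli.mat_eq, hs, Matrix.smul_mul, PauliString.mat_mul_self,
      show sgn true = -1 by simp [sgn], neg_one_smul] at hm

/-! ### Stabilizer subgroups exist -/

/-- The average over `S` needs a nonzero denominator. The witness consists of all `Z` strings on the
first `n - k` qubits. -/
theorem stab_nonempty (hk : k ≤ n) : Nonempty (Stab n k) := by
  classical
  set w : Finset (Fin n) := Finset.univ.filter fun l => (l : ℕ) < n - k with hw
  have hmem : ∀ l, l ∈ w ↔ (l : ℕ) < n - k := by simp [hw]
  have hwc : w.card = n - k := by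
    rw [hw, Fin.card_filter_val_lt, min_eq_right (by omega)]
  have hz : ∀ J : Finset (Fin n), SignedPauli.mat ((false, zString J) : SignedPauli n) =
      (zString J).mat := fun J => by simp [SignedPauli.mat]
  have hinj : Function.Injective fun J : Finset (Fin n) => ((false, zString J) : SignedPauli n) :=
    fun J K h => zString_injective (Prod.ext_iff.1 h).2
  refine ⟨⟨w.powerset.image fun J => (false, zString J), ⟨fun r => (false, zString {⟨r, by omega⟩}), ?_⟩,
    ?_, ?_, ?_⟩⟩
  · rw [Generates]
    apply Set.Subset.antisymm
    · rintro _ ⟨P, hP, rfl⟩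
      obtain ⟨J, hJ, rfl⟩ := Finset.mem_image.1 (Finset.mem_coe.1 hP)
      rw [Finset.mem_powerset] at hJ
      rw [hz]
      clear hP
      induction J using Finset.induction_on with
      | empty => rw [zString_empty]; exact Submonoid.one_mem _
      | insert a J ha ih =>
        have h1 : (zString (insert a J)).mat = (zString {a}).mat * (zString J).mat := by
          rw [zString_mul]
          congr 2
          ext x
          by_cases hx : x = a <;> by_cases hxJ : x ∈ J <;>
            simp_all [Finset.mem_symmDiff]
        rw [h1]
        have ha' := (hmem a).1 (hJ (Finset.mem_insert_self a J))
        refine Submonoid.mul_mem _ (Submonoid.subset_closure ⟨⟨a, ha'⟩, by simp [hz]⟩)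
          (ih ((Finset.subset_insert a J).trans hJ))
    · intro M hM
      induction hM using Submonoid.closure_induction with
      | mem x hx =>
        obtain ⟨r, rfl⟩ := hx
        refine ⟨_, Finset.mem_coe.2 (Finset.mem_image_of_mem _ ?_), rfl⟩
        rw [Finset.mem_powerset, Finset.singleton_subset_iff, hmem]
        exact r.2
      | one =>
        refine ⟨_, Finset.mem_coe.2 (Finset.mem_image_of_mem _ (Finset.empty_mem_powerset w)), ?_⟩
        rw [hz, zString_empty]
      | mul x y _ _ hx hy =>
        obtain ⟨P, hP, rfl⟩ := hx
        obtain ⟨Q, hQ, rfl⟩ := hy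
        obtain ⟨J, hJ, rfl⟩ := Finset.mem_image.1 (Finset.mem_coe.1 hP)
        obtain ⟨K, hK, rfl⟩ := Finset.mem_image.1 (Finset.mem_coe.1 hQ)
        refine ⟨_, Finset.mem_coe.2 (Finset.mem_image_of_mem _
          (Finset.mem_powerset.2 (fun x hx => ?_ : symmDiff J K ⊆ w))), ?_⟩
        · rcases Finset.mem_symmDiff.1 hx with h | h
          · exact Finset.mem_powerset.1 hJ h.1
          · exact Finset.mem_powerset.1 hK h.1
        · simp only [hz, zString_mul]
  · intro P hP Q hQ
    obtain ⟨J, -, rfl⟩ := Finset.mem_image.1 hP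
    obtain ⟨K, -, rfl⟩ := Finset.mem_image.1 hQ
    rw [hz, hz, zString_mul, zString_mul, symmDiff_comm]
  · simp
  · rw [Finset.card_image_of_injective _ hinj, Finset.card_powerset, hwc]

/-! ### The success probability -/

/-- The `n`-bit string `0^{n-k} x`. -/
def padBits (hk : k ≤ n) (x : Bits k) : Bits n :=
  fun j => if h : n - k ≤ j then x ⟨j - (n - k), by omega⟩ else 0

theorem lastBits_padBits (hk : k ≤ n) (x : Bits k) : lastBits hk (padBits hk x) = x := by
  ext1 i
  simp [lastBits, padBits]

theorem zeroPad_single (hk : k ≤ n) (x : Bits k) :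
    zeroPad hk (Pi.single x 1) = Pi.single (padBits hk x) 1 := by
  ext b
  by_cases hb : b = padBits hk x
  · subst hb
    rw [zeroPad, lastBits_padBits, if_pos]
    · simp
    · intro j hj
      simp [padBits, not_le.2 hj]
  · rw [Pi.single_eq_of_ne hb, zeroPad]
    split_ifs with h
    · refine Pi.single_eq_of_ne (fun e => hb ?_) 1
      ext1 j
      by_cases hj : n - k ≤ j
      · have := congrFun e ⟨j - (n - k), by omega⟩
        simp only [lastBits] at this
        simp only [padBits, hj, dite_true, ← this]
        congr 1
        ext
        simp only
        omega
      · simp [padBits, hj, h j (not_le.1 hj)]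
    · rfl

/-- The probability that the error `E` leaves the decoded string `b` unchanged. -/
noncomputable def stayProb (U : Op n) (b : Bits n) (E : PauliString n) : ℝ :=
  Complex.normSq ((Uᴴ * E.mat * U) b b)

/-- The Born rule: the sandwiched projector is the projector on the vector `V E U |b⟩`. -/
theorem conj_vecMulVec_diag (V E U : Op n) (a b : Bits n) :
    (V * (E * Matrix.vecMulVec (U *ᵥ Pi.single b 1) (star (U *ᵥ Pi.single b 1)) * Eᴴ) * Vᴴ) a a
      = Complex.normSq ((V * E * U) a b) := by
  have h : V * (E * Matrix.vecMulVec (U *ᵥ Pi.single b 1) (star (U *ᵥ Pi.single b 1)) * Eᴴ) * Vᴴ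
      = Matrix.vecMulVec ((V * E * U) *ᵥ Pi.single b 1) (star ((V * E * U) *ᵥ Pi.single b 1)) := by
    simp only [Matrix.mul_vecMulVec, Matrix.vecMulVec_mul, Matrix.star_mulVec,
      Matrix.conjTranspose_mul, Matrix.mulVec_mulVec, Matrix.vecMul_vecMul, mul_assoc]
  rw [h, Matrix.vecMulVec_apply, Matrix.mulVec_single_one]
  simp [Matrix.col_apply, Complex.mul_conj]

/-- Of all outcomes that end in `x`, only `0^{n-k} x` is kept; the others contribute nonnegative
amounts. -/
theorem le_algorithm1Output (hk : k ≤ n) (c : Circuit n) (p : ℝ) (hp : 0 ≤ p) (hp1 : p ≤ 1)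
    (x : Bits k) :
    ∑ E : PauliString n, (p / 3) ^ E.weight * (1 - p) ^ (n - E.weight) *
        stayProb c.mat (padBits hk x) E ≤
      algorithm1Output hk c (noisyCodeword hk p c.mat x) x := by
  have hdiag : ∀ b : Bits n,
      ((c.inv.mat * noisyCodeword hk p c.mat x * c.inv.matᴴ) b b).re =
        ∑ E : PauliString n, (p / 3) ^ E.weight * (1 - p) ^ (n - E.weight) *
          Complex.normSq ((c.matᴴ * E.mat * c.mat) b (padBits hk x)) := by
    intro b
    rw [noisyCodeword, depolarize, codeword, zeroPad_single, Finset.mul_sum, Finset.sum_mul,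
      Matrix.sum_apply, Complex.re_sum]
    refine Finset.sum_congr rfl fun E _ => ?_
    rw [Matrix.mul_smul, Matrix.smul_mul, Matrix.smul_apply, conj_vecMulVec_diag, smul_eq_mul,
      Complex.re_ofReal_mul, Complex.ofReal_re, c.inv_mat]
  rw [algorithm1Output]
  have hnn : ∀ b : Bits n, 0 ≤ ((c.inv.mat * noisyCodeword hk p c.mat x * c.inv.matᴴ) b b).re := by
    intro b
    rw [hdiag]
    refine Finset.sum_nonneg fun E _ => mul_nonneg (mul_nonneg ?_ ?_) (Complex.normSq_nonneg _)
    · positivity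
    · exact pow_nonneg (by linarith) _
  refine le_trans (le_of_eq ?_) (Finset.single_le_sum (fun b _ => hnn b)
    (Finset.mem_filter.2 ⟨Finset.mem_univ (padBits hk x), lastBits_padBits hk x⟩))
  rw [hdiag]
  rfl

theorem stayProb_one (c : Circuit n) (b : Bits n) : stayProb c.mat b (fun _ => Pauli.I) = 1 := by
  rw [stayProb, PauliString.mat_one, mul_one, c.mat_conjTranspose_mul]
  simp

/-- Bernoulli's inequality with exponent `n` would only give `0`. With the real exponent `n / 2 ≥ 1`
it gives `1/2`, which is then squared. -/
theorem quarter_le_pow (hn : 2 ≤ n) : (1 / 4 : ℝ) ≤ (1 - 1 / n) ^ n := by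
  have hn' : (2 : ℝ) ≤ n := by exact_mod_cast hn
  have h0 : (1 / n : ℝ) ≤ 1 := by rw [div_le_one (by linarith)]; linarith
  have h1 := one_add_mul_self_le_rpow_one_add (s := -(1 / n : ℝ)) (by linarith)
    (p := n / 2) (by linarith)
  have h2 : (1 : ℝ) + n / 2 * -(1 / n) = 1 / 2 := by field_simp; norm_num
  rw [h2] at h1
  have h3 : (((1 : ℝ) + -(1 / n)) ^ ((n : ℝ) / 2)) ^ 2 = (1 - 1 / n) ^ n := by
    rw [← Real.rpow_mul_natCast (by linarith)]
    rw [show (n : ℝ) / 2 * (2 : ℕ) = n by push_cast; ring, Real.rpow_natCast, ← sub_eq_add_neg]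
  rw [← h3]
  nlinarith

theorem sum_bits_one {M : Type*} [AddCommMonoid M] (f : Bits 1 → M) :
    ∑ b, f b = f (fun _ => 0) + f (fun _ => 1) := by
  rw [← (Equiv.funUnique (Fin 1) (Fin 2)).symm.sum_comp, Fin.sum_univ_two]
  rfl

theorem sum_pauliString_one {M : Type*} [AddCommMonoid M] (f : PauliString 1 → M) :
    ∑ E, f E = f (fun _ => .I) + (f (fun _ => .X) + (f (fun _ => .Y) + f (fun _ => .Z))) := by
  rw [← (Equiv.funUnique (Fin 1) Pauli).symm.sum_comp,
    show (Finset.univ : Finset Pauli) = {.I, .X, .Y, .Z} from rfl, Finset.sum_insert (by decide),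
    Finset.sum_insert (by decide), Finset.sum_pair (by decide)]
  rfl

/-- The three amplitudes are the expectations of `X`, `Y`, `Z` in a pure state, that is, the
coordinates of its Bloch vector. For the column `(α, β)` of the circuit, the sum of their squares is
`(|α|² + |β|²)²`. -/
theorem stayProb_sum_one (c : Circuit 1) (b : Bits 1) :
    stayProb c.mat b (fun _ => .X) + stayProb c.mat b (fun _ => .Y)
      + stayProb c.mat b (fun _ => .Z) = 1 := by
  have hU := congrFun (congrFun c.mat_conjTranspose_mul b) b
  rw [Matrix.mul_apply, sum_bits_one] at hU
  simp only [Matrix.conjTranspose_apply, Matrix.one_apply_eq, RCLike.star_def] at hU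
  have hU' := congrArg Complex.re hU
  simp only [stayProb, Matrix.mul_apply, sum_bits_one, PauliString.mat, tensor, Matrix.of_apply,
    Finset.univ_unique, Finset.prod_singleton, Pauli.mat, Matrix.conjTranspose_apply, RCLike.star_def,
    Complex.normSq_apply]
  generalize c.mat (fun _ => 0) b = α at *
  generalize c.mat (fun _ => 1) b = β at *
  simp at hU' ⊢
  have h2 : (α.re * α.re + α.im * α.im + (β.re * β.re + β.im * β.im)) ^ 2 = 1 := by
    rw [hU']; norm_num
  linear_combination h2

theorem quarter_le_algorithm1Output (hn : 1 ≤ n) (hk : k ≤ n) (c : Circuit n) (x : Bits k) :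
    0.25 ≤ algorithm1Output hk c (noisyCodeword hk (1 / (n : ℝ)) c.mat x) x := by
  have hn' : (1 : ℝ) ≤ n := by exact_mod_cast hn
  have hp1 : (1 / n : ℝ) ≤ 1 := by rw [div_le_one (by linarith)]; exact hn'
  refine le_trans ?_ (le_algorithm1Output hk c (1 / n) (by positivity) hp1 x)
  rcases hn.eq_or_lt with rfl | hn2
  -- At `n = 1` the noise rate is `1`: the identity has weight zero, and the three errors together
  -- contribute `1/3`.
  · have hw : ∀ P : Pauli, PauliString.weight (fun _ : Fin 1 => P) = if P = .I then 0 else 1 := by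
      intro P
      cases P <;> simp [PauliString.weight]
    have := stayProb_sum_one c (padBits hk x)
    rw [sum_pauliString_one]
    simp only [hw, reduceCtorEq, if_true, if_false]
    norm_num
    linarith
  · have hterm : ∀ E : PauliString n, 0 ≤ (1 / (n : ℝ) / 3) ^ E.weight *
        (1 - 1 / (n : ℝ)) ^ (n - E.weight) * stayProb c.mat (padBits hk x) E := fun E =>
      mul_nonneg (mul_nonneg (by positivity) (pow_nonneg (by linarith) _)) (Complex.normSq_nonneg _)
    refine le_trans ?_ (Finset.single_le_sum (fun E _ => hterm E)
      (Finset.mem_univ (fun _ => Pauli.I)))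
    have := quarter_le_pow hn2
    simp only [stayProb_one, PauliString.weight]
    norm_num at this ⊢
    exact this

theorem quarter_le_successProb (hn : 1 ≤ n) (hk : k ≤ n) (enc : Stab n k → Circuit n) :
    0.25 ≤ successProb hk (1 / (n : ℝ)) (fun S => (enc S).mat)
      (fun S => algorithm1Output hk (enc S)) := by
  have := stab_nonempty hk
  have hpos : (0 : ℝ) < Fintype.card (Stab n k) := by exact_mod_cast Fintype.card_pos
  rw [successProb, le_div_iff₀ (by positivity)]
  have h : ∑ _S : Stab n k, ∑ _x : Bits k, (0.25 : ℝ) =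
      0.25 * ((Fintype.card (Stab n k) : ℝ) * 2 ^ k) := by
    simp
    ring
  rw [← h]
  exact Finset.sum_le_sum fun S _ => Finset.sum_le_sum fun x _ =>
    quarter_le_algorithm1Output hn hk (enc S) x

/-! ### Reasoning about programs -/

/-- Started on `s`, the program halts within `B` steps, having written a circuit `c` of at most
`L` gates, with a memory `s'` such that `Q s' c`. -/
def Runs (p : Program) (s : Store) (B L : ℕ) (Q : Store → Circuit n → Prop) : Prop :=
  ∃ s' c t, Exec p s s' (c.map Gate.raw) t ∧ t ≤ B ∧ c.length ≤ L ∧ Q s' c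

theorem Runs.mono {p : Program} {s : Store} {B B' L L' : ℕ} {Q Q' : Store → Circuit n → Prop}
    (h : Runs p s B L Q) (hB : B ≤ B') (hL : L ≤ L') (hQ : ∀ s' c, Q s' c → Q' s' c) :
    Runs p s B' L' Q' := by
  obtain ⟨s', c, t, he, ht, hl, hq⟩ := h
  exact ⟨s', c, t, he, ht.trans hB, hl.trans hL, hQ _ _ hq⟩

theorem Runs.seq {p q : Program} {s : Store} {B₁ B₂ L₁ L₂ : ℕ} {Q : Store → Circuit n → Prop}
    (h : Runs p s B₁ L₁ fun s₁ c₁ => Runs q s₁ B₂ L₂ fun s₂ c₂ => Q s₂ (c₁ ++ c₂)) :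
    Runs (.seq p q) s (B₁ + B₂) (L₁ + L₂) Q := by
  obtain ⟨s₁, c₁, t₁, he₁, ht₁, hl₁, s₂, c₂, t₂, he₂, ht₂, hl₂, hq⟩ := h
  refine ⟨s₂, c₁ ++ c₂, t₁ + t₂, ?_, by omega, by rw [List.length_append]; omega, hq⟩
  rw [List.map_append]
  exact .seq he₁ he₂

theorem Runs.ifLt {x y : ℕ} {p q : Program} {s : Store} {B L : ℕ} {Q : Store → Circuit n → Prop}
    (hp : s.reg x < s.reg y → Runs p s B L Q) (hq : ¬ s.reg x < s.reg y → Runs q s B L Q) :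
    Runs (.ifLt x y p q) s (B + 1) L Q := by
  by_cases h : s.reg x < s.reg y
  · obtain ⟨s', c, t, he, ht, hl, hQ⟩ := hp h
    exact ⟨s', c, t + 1, .ifTrue h he, by omega, hl, hQ⟩
  · obtain ⟨s', c, t, he, ht, hl, hQ⟩ := hq h
    exact ⟨s', c, t + 1, .ifFalse h he, by omega, hl, hQ⟩

/-- The circuit in `Inv` is everything written so far, including what precedes the loop. In `B + 2`
the extra steps are the test and the increment; the final `+ 1` is the failing test. -/
theorem Runs.loop {x y N B L : ℕ} {b : Program} (Inv : ℕ → Store → Circuit n → Prop)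
    (hreg : ∀ a s c, Inv a s c → s.reg x = a ∧ s.reg y = N)
    (hstep : ∀ a s c, a < N → Inv a s c →
      Runs b s B L fun s' d => s'.reg x = a ∧ Inv (a + 1) (s'.setReg x (a + 1)) (c ++ d))
    {a : ℕ} {s : Store} {c : Circuit n} (ha : a ≤ N) (h : Inv a s c) :
    Runs (.whileLt x y (.seq b (.succ x))) s ((N - a) * (B + 2) + 1) ((N - a) * L)
      fun s' d => Inv N s' (c ++ d) := by
  induction e : N - a generalizing a s c with
  | zero =>
    refine ⟨s, [], 1, .whileFalse ?_, by omega, by simp, ?_⟩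
    · rw [(hreg a s c h).1, (hreg a s c h).2]
      omega
    · change Inv N s (c ++ [])
      rwa [List.append_nil, show N = a by omega]
  | succ e ih =>
    obtain ⟨s₁, d₁, t₁, he₁, ht₁, hl₁, hx, hI⟩ := hstep a s c (by omega) h
    obtain ⟨s₂, d₂, t₂, he₂, ht₂, hl₂, hq⟩ := ih (by omega) hI (by omega)
    have hlt : s.reg x < s.reg y := by
      rw [(hreg a s c h).1, (hreg a s c h).2]; omega
    have hs := Exec.succ s₁ x
    rw [hx] at hs
    have := Exec.whileTrue hlt (.seq he₁ hs) he₂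
    refine ⟨s₂, d₁ ++ d₂, _, by rw [List.map_append]; simpa using this, ?_, ?_, ?_⟩
    · rw [add_mul]; omega
    · rw [add_mul, List.length_append]; omega
    · change Inv N s₂ (c ++ (d₁ ++ d₂))
      rwa [← List.append_assoc]

namespace Program

/-- Programs without loops that write nothing on the tape. -/
def straight : Program → Bool
  | seq c d => c.straight && d.straight
  | ifLt _ _ c d => c.straight && d.straight
  | whileLt _ _ _ => false
  | emitHad _ => false
  | emitPhase _ => false
  | emitCnot _ _ => false
  | _ => true

/-- The effect of a loop-free program on the memory. -/
def eval : Program → Store → Store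
  | skip, s => s
  | zero x, s => s.setReg x 0
  | succ x, s => s.setReg x (s.reg x + 1)
  | copy x y, s => s.setReg x (s.reg y)
  | load x a i j, s => s.setReg x (s.arr a (s.reg i) (s.reg j))
  | store a i j x, s => s.setArr a (s.reg i) (s.reg j) (s.reg x)
  | seq c d, s => d.eval (c.eval s)
  | ifLt x y c d, s => if s.reg x < s.reg y then c.eval s else d.eval s
  | _, s => s

/-- A bound for the running time of a loop-free program. -/
def cost : Program → ℕ
  | seq c d => c.cost + d.cost
  | ifLt _ _ c d => c.cost + d.cost + 1
  | _ => 1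

/-- Correctness of loop-free code becomes a computation with `eval`, which `simp` can carry out. -/
theorem exec_eval (p : Program) (h : p.straight) (s : Store) :
    ∃ t ≤ p.cost, Exec p s (p.eval s) [] t := by
  induction p generalizing s with
  | skip => exact ⟨1, le_rfl, .skip _⟩
  | zero x => exact ⟨1, le_rfl, .zero _ _⟩
  | succ x => exact ⟨1, le_rfl, .succ _ _⟩
  | copy x y => exact ⟨1, le_rfl, .copy _ _ _⟩
  | load x a i j => exact ⟨1, le_rfl, .load _ _ _ _ _⟩
  | store a i j x => exact ⟨1, le_rfl, .store _ _ _ _ _⟩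
  | emitHad i => simp [straight] at h
  | emitPhase i => simp [straight] at h
  | emitCnot i j => simp [straight] at h
  | seq c d hc hd =>
    simp only [straight, Bool.and_eq_true] at h
    obtain ⟨t₁, h₁, e₁⟩ := hc h.1 s
    obtain ⟨t₂, h₂, e₂⟩ := hd h.2 (c.eval s)
    exact ⟨t₁ + t₂, by simp only [cost]; omega, .seq e₁ e₂⟩
  | ifLt x y c d hc hd =>
    simp only [straight, Bool.and_eq_true] at h
    obtain ⟨t₁, h₁, e₁⟩ := hc h.1 s
    obtain ⟨t₂, h₂, e₂⟩ := hd h.2 s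
    by_cases hxy : s.reg x < s.reg y
    · exact ⟨t₁ + 1, by simp only [cost]; omega, by simpa only [eval, hxy, if_true] using .ifTrue hxy e₁⟩
    · exact ⟨t₂ + 1, by simp only [cost]; omega, by simpa only [eval, hxy, if_false] using .ifFalse hxy e₂⟩
  | whileLt x y c _ => simp [straight] at h

/-- Programs that only change registers from `8` on and array rows with the index `reg 7`. -/
def rowLocal : Program → Bool
  | zero x => 8 ≤ x
  | succ x => 8 ≤ x
  | copy x _ => 8 ≤ x
  | load x _ _ _ => 8 ≤ x
  | store _ i _ _ => i = 7
  | seq c d => c.rowLocal && d.rowLocal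
  | ifLt _ _ c d => c.rowLocal && d.rowLocal
  | _ => true

/-- A frame rule: row updates disturb neither the loop counters and constants in low registers nor
the other generators. -/
theorem eval_of_rowLocal (p : Program) (h : p.rowLocal) (s : Store) :
    (∀ x < 8, (p.eval s).reg x = s.reg x) ∧
      ∀ a i j, i ≠ s.reg 7 → (p.eval s).arr a i j = s.arr a i j := by
  have hreg : ∀ x v : ℕ, 8 ≤ x → (∀ y < 8, (s.setReg x v).reg y = s.reg y) ∧
      ∀ a i j, i ≠ s.reg 7 → (s.setReg x v).arr a i j = s.arr a i j := fun x v hx =>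
    ⟨fun y hy => Function.update_of_ne (by omega) _ _, fun _ _ _ _ => rfl⟩
  induction p generalizing s with
  | zero x => exact hreg _ _ (by simpa [rowLocal] using h)
  | succ x => exact hreg _ _ (by simpa [rowLocal] using h)
  | copy x y => exact hreg _ _ (by simpa [rowLocal] using h)
  | load x a i j => exact hreg _ _ (by simpa [rowLocal] using h)
  | store a i j x =>
    obtain rfl : i = 7 := by simpa [rowLocal] using h
    refine ⟨fun _ _ => rfl, fun a' i' j' hi => ?_⟩
    simp [eval, Store.setArr, hi]
  | seq c d hc hd =>
    simp only [rowLocal, Bool.and_eq_true] at h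
    have h₁ := hc h.1 s hreg
    have h₂ := hd h.2 (c.eval s) fun x v hx =>
      ⟨fun y hy => Function.update_of_ne (by omega) _ _, fun _ _ _ _ => rfl⟩
    refine ⟨fun x hx => (h₂.1 x hx).trans (h₁.1 x hx), fun a i j hi => ?_⟩
    exact (h₂.2 a i j (by rwa [h₁.1 7 (by norm_num)])).trans (h₁.2 a i j hi)
  | ifLt x y c d hc hd =>
    simp only [rowLocal, Bool.and_eq_true] at h
    rw [eval]
    split_ifs
    · exact hc h.1 s hreg
    · exact hd h.2 s hreg
  | _ => exact ⟨fun _ _ => rfl, fun _ _ _ _ => rfl⟩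

end Program

theorem Runs.straight {p : Program} (hp : p.straight) {s : Store} {Q : Store → Circuit n → Prop}
    (h : Q (p.eval s) []) : Runs p s p.cost 0 Q := by
  obtain ⟨t, ht, he⟩ := p.exec_eval hp s
  exact ⟨_, [], t, he, ht, le_rfl, h⟩

/-! ### Conjugating the stored generators by a gate -/

open Program

/-- The memory holds the generators `h`; registers `0`, `2`, `3` hold `n`, `m` and `0`. -/
structure Holds (s : Store) (h : Fin m → SignedPauli n) : Prop where
  cols : s.reg 0 = n
  rows : s.reg 2 = m
  zero : s.reg 3 = 0
  x : ∀ (r : Fin m) (q : Fin n), s.arr 0 r q = ((h r).2 q).xBit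
  z : ∀ (r : Fin m) (q : Fin n), s.arr 1 r q = ((h r).2 q).zBit
  sign : ∀ r : Fin m, s.arr 2 r 0 = (h r).1.toNat

/-- Negate the bit in register `x`. -/
def flipReg (x : ℕ) : Program := ifLt 3 x (zero x) (succ x)

/-- Conjugate row `reg 7` by a Hadamard gate on the qubit in register `p`. -/
def hadRow (p : ℕ) : Program :=
  seq (load 8 0 7 p) <| seq (load 9 1 7 p) <| seq (load 10 2 7 3) <|
  seq (ifLt 3 8 (ifLt 3 9 (flipReg 10) skip) skip) <|
  seq (store 0 7 p 9) <| seq (store 1 7 p 8) (store 2 7 3 10)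

/-- Conjugate row `reg 7` by a phase gate on the qubit in register `p`. -/
def phaseRow (p : ℕ) : Program :=
  seq (load 8 0 7 p) <| seq (load 9 1 7 p) <| seq (load 10 2 7 3) <|
  seq (ifLt 3 8 (seq (ifLt 3 9 skip (flipReg 10)) (flipReg 9)) skip) <|
  seq (store 1 7 p 9) (store 2 7 3 10)

/-- Conjugate row `reg 7` by a CNOT gate from the qubit in register `p` to that in `q`. -/
def cnotRow (p q : ℕ) : Program :=
  seq (load 8 0 7 p) <| seq (load 9 1 7 p) <| seq (load 10 2 7 3) <|
  seq (load 11 0 7 q) <| seq (load 12 1 7 q) <|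
  seq (ifLt 3 8 (ifLt 3 12 (ifLt 3 11 (ifLt 3 9 (flipReg 10) skip)
    (ifLt 3 9 skip (flipReg 10))) skip) skip) <|
  seq (ifLt 3 8 (flipReg 11) skip) <| seq (ifLt 3 12 (flipReg 9) skip) <|
  seq (store 0 7 q 11) <| seq (store 1 7 p 9) (store 2 7 3 10)

theorem Holds.conjRow {s : Store} {h : Fin m → SignedPauli n} (hs : Holds s h) {b : Program}
    (hb : b.rowLocal) (r : Fin m) (hr : s.reg 7 = r) (P : SignedPauli n)
    (hx : ∀ q : Fin n, (b.eval s).arr 0 r q = (P.2 q).xBit)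
    (hz : ∀ q : Fin n, (b.eval s).arr 1 r q = (P.2 q).zBit)
    (hsign : (b.eval s).arr 2 r 0 = P.1.toNat) :
    Holds (b.eval s) (Function.update h r P) := by
  obtain ⟨h1, h2⟩ := b.eval_of_rowLocal hb s
  rw [hr] at h2
  refine ⟨(h1 0 (by norm_num)).trans hs.cols, (h1 2 (by norm_num)).trans hs.rows,
    (h1 3 (by norm_num)).trans hs.zero, fun r' q => ?_, fun r' q => ?_, fun r' => ?_⟩ <;>
  · by_cases e : r' = r
    · subst e
      simp [hx, hz, hsign]
    · rw [h2 _ _ _ (fun e' => e (Fin.ext e'))]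
      simp [e, hs.x, hs.z, hs.sign]

/-- A truth table over the label and the sign. Register `3` holds `0`, so the test `3 < x` reads a
bit, and `p < 7` keeps the operand clear of the scratch registers. -/
theorem hadRow_spec {s : Store} {h : Fin m → SignedPauli n} (hs : Holds s h) {p : ℕ} (hp : p < 7)
    (i : Fin n) (hpi : s.reg p = i) (r : Fin m) (hr : s.reg 7 = r) :
    Holds ((hadRow p).eval s) (Function.update h r ((Gate.had i).conj (h r))) := by
  have hx := hs.x r i
  have hz := hs.z r i
  have hsg := hs.sign r
  have h8 : p ≠ 8 := by omega
  have h9 : p ≠ 9 := by omega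
  have h10 : p ≠ 10 := by omega
  refine hs.conjRow rfl r hr _ (fun q => ?_) (fun q => ?_) ?_ <;>
    cases hP : (h r).2 i <;> cases hS : (h r).1 <;>
    simp only [hP, hS, Pauli.xBit, Pauli.zBit, Bool.toNat_true, Bool.toNat_false] at hx hz hsg
  -- The `X`-bit and `Z`-bit goals come first, each with four labels times two signs; the remaining
  -- eight goals concern the sign.
  iterate 16
    by_cases hq : q = i
    · subst hq
      simp [hadRow, flipReg, eval, Store.setReg, Store.setArr, hs.zero, hpi, hr, h8, h9, h10,
        hx, hz, hsg, Pauli.xBit, Pauli.zBit, Gate.conj, hP, Pauli.had]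
    · simp [hadRow, flipReg, eval, Store.setReg, Store.setArr, hs.zero, hpi, hr, h8, h9, h10,
        hx, hz, hsg, Gate.conj, hq, hs.x, hs.z, Fin.val_inj]
  all_goals
    simp [hadRow, flipReg, eval, Store.setReg, Store.setArr, hs.zero, hpi, hr, h8, h9, h10,
      hx, hz, hsg, Gate.conj, hP, hS]

theorem phaseRow_spec {s : Store} {h : Fin m → SignedPauli n} (hs : Holds s h) {p : ℕ}
    (hp : p < 7) (i : Fin n) (hpi : s.reg p = i) (r : Fin m) (hr : s.reg 7 = r) :
    Holds ((phaseRow p).eval s) (Function.update h r ((Gate.phase i).conj (h r))) := by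
  have hx := hs.x r i
  have hz := hs.z r i
  have hsg := hs.sign r
  have h8 : p ≠ 8 := by omega
  have h9 : p ≠ 9 := by omega
  have h10 : p ≠ 10 := by omega
  refine hs.conjRow rfl r hr _ (fun q => ?_) (fun q => ?_) ?_ <;>
    cases hP : (h r).2 i <;> cases hS : (h r).1 <;>
    simp only [hP, hS, Pauli.xBit, Pauli.zBit, Bool.toNat_true, Bool.toNat_false] at hx hz hsg
  iterate 16
    by_cases hq : q = i
    · subst hq
      simp [phaseRow, flipReg, eval, Store.setReg, Store.setArr, hs.zero, hpi, hr, h8, h9, h10,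
        hx, hz, hsg, Pauli.xBit, Pauli.zBit, Gate.conj, hP, Pauli.phase]
    · simp [phaseRow, flipReg, eval, Store.setReg, Store.setArr, hs.zero, hpi, hr, h8, h9, h10,
        hx, hz, hsg, Gate.conj, hq, hs.x, hs.z, Fin.val_inj]
  all_goals
    simp [phaseRow, flipReg, eval, Store.setReg, Store.setArr, hs.zero, hpi, hr, h8, h9, h10,
      hx, hz, hsg, Gate.conj, hP, hS]

set_option maxHeartbeats 1000000 in
theorem cnotRow_spec {s : Store} {h : Fin m → SignedPauli n} (hs : Holds s h) {p q : ℕ}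
    (hp : p < 7) (hq : q < 7) (i j : Fin n) (hij : i ≠ j) (hpi : s.reg p = i) (hqj : s.reg q = j)
    (r : Fin m) (hr : s.reg 7 = r) :
    Holds ((cnotRow p q).eval s) (Function.update h r ((Gate.cnot i j hij).conj (h r))) := by
  have hxi := hs.x r i
  have hzi := hs.z r i
  have hxj := hs.x r j
  have hzj := hs.z r j
  have hsg := hs.sign r
  have h8 : p ≠ 8 := by omega
  have h9 : p ≠ 9 := by omega
  have h10 : p ≠ 10 := by omega
  have h11 : p ≠ 11 := by omega
  have h12 : p ≠ 12 := by omega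
  have g8 : q ≠ 8 := by omega
  have g9 : q ≠ 9 := by omega
  have g10 : q ≠ 10 := by omega
  have g11 : q ≠ 11 := by omega
  have g12 : q ≠ 12 := by omega
  refine hs.conjRow rfl r hr _ (fun l => ?_) (fun l => ?_) ?_ <;>
    cases hP : (h r).2 i <;> cases hQ : (h r).2 j <;> cases hS : (h r).1 <;>
    simp only [hP, hQ, hS, Pauli.xBit, Pauli.zBit, Bool.toNat_true, Bool.toNat_false]
      at hxi hzi hxj hzj hsg
  -- Two kinds of bits, sixteen pairs of labels and two signs; the sign goals remain.
  iterate 64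
    by_cases hl : l = i
    · subst hl
      simp [cnotRow, flipReg, eval, Store.setReg, Store.setArr, hs.zero, *,
        Pauli.xBit, Pauli.zBit, Gate.conj, Pauli.ofBits, Pauli.hasX, Pauli.hasZ, Fin.val_inj]
    · by_cases hl' : l = j
      · subst hl'
        simp [cnotRow, flipReg, eval, Store.setReg, Store.setArr, hs.zero, *,
          Pauli.xBit, Pauli.zBit, Gate.conj, Pauli.ofBits, Pauli.hasX, Pauli.hasZ, Fin.val_inj]
      · simp [cnotRow, flipReg, eval, Store.setReg, Store.setArr, hs.zero, *,
          Pauli.xBit, Pauli.zBit, Gate.conj, hs.x, hs.z, Fin.val_inj]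
  all_goals
    simp [cnotRow, flipReg, eval, Store.setReg, Store.setArr, hs.zero, *,
      Gate.conj, Pauli.hasX, Pauli.hasZ, Pauli.xBit, Pauli.zBit]

/-- The registers below `7` have the same contents. -/
def SameRegs (s s' : Store) : Prop := ∀ x < 7, s'.reg x = s.reg x

theorem SameRegs.trans {s₁ s₂ s₃ : Store} (h : SameRegs s₁ s₂) (h' : SameRegs s₂ s₃) :
    SameRegs s₁ s₃ := fun x hx => (h' x hx).trans (h x hx)

theorem Holds.setReg {s : Store} {h : Fin m → SignedPauli n} (hs : Holds s h) {x : ℕ}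
    (hx : 3 < x) (v : ℕ) : Holds (s.setReg x v) h :=
  ⟨(Function.update_of_ne (by omega) _ _).trans hs.cols,
    (Function.update_of_ne (by omega) _ _).trans hs.rows,
    (Function.update_of_ne (by omega) _ _).trans hs.zero, hs.x, hs.z, hs.sign⟩

theorem Store.setReg_self (s : Store) (x v : ℕ) : (s.setReg x v).reg x = v :=
  Function.update_self _ _ _

theorem Store.setReg_of_ne (s : Store) {x y : ℕ} (h : y ≠ x) (v : ℕ) :
    (s.setReg x v).reg y = s.reg y :=
  Function.update_of_ne h _ _

theorem SameRegs.setReg (s : Store) {x : ℕ} (hx : 7 ≤ x) (v : ℕ) : SameRegs s (s.setReg x v) :=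
  fun _ hy => Store.setReg_of_ne _ (by omega) _

/-- Run `b` on every row, then `e`. -/
def eachRow (b e : Program) : Program :=
  seq (zero 7) (seq (whileLt 7 2 (seq b (succ 7))) e)

/-- The loop invariant is that exactly the rows before the counter have been conjugated. The cost is
at most `37 m + 3`, where `37 = 35 + 2`. -/
theorem eachRow_runs (hmn : m ≤ n) (hn : 1 ≤ n) {b e : Program} {G : Gate n} {s : Store}
    {h : Fin m → SignedPauli n} (hs : Holds s h) (hstr : b.straight) (hloc : b.rowLocal)
    (hcost : b.cost ≤ 35)
    (hb : ∀ s' (h' : Fin m → SignedPauli n) (r : Fin m), Holds s' h' → s'.reg 7 = r →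
      SameRegs s s' → Holds (b.eval s') (Function.update h' r (G.conj (h' r))))
    (he : ∀ s', SameRegs s s' → Exec e s' s' [G.raw] 1) :
    Runs (eachRow b e) s (40 * n) 1 fun s' (c : Circuit n) =>
      c = [G] ∧ Holds s' (fun r => G.conj (h r)) ∧ SameRegs s s' := by
  let Inv : ℕ → Store → Circuit n → Prop := fun a s' c => c = [] ∧ s'.reg 7 = a ∧
    SameRegs s s' ∧ Holds s' fun r : Fin m => if (r : ℕ) < a then G.conj (h r) else h r
  have hloop := Runs.loop (n := n) (x := 7) (y := 2) (N := m) (B := b.cost) (L := 0) (b := b) Inv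
    (fun a s' c hI => ⟨hI.2.1, hI.2.2.2.rows⟩) (by
      rintro a s' c ha ⟨rfl, h7, hsame, hH⟩
      refine Runs.straight hstr ?_
      have hreg := (b.eval_of_rowLocal hloc s').1
      refine ⟨(hreg 7 (by norm_num)).trans h7, rfl, Store.setReg_self _ _ _,
        (hsame.trans fun x hx => hreg x (by omega)).trans (.setReg _ le_rfl _), ?_⟩
      have hH' := (hb s' _ ⟨a, ha⟩ hH h7 hsame).setReg (x := 7) (by norm_num) (a + 1)
      convert hH' using 1
      ext1 r
      by_cases hr : r = ⟨a, ha⟩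
      · subst hr
        simp
      · have : (r : ℕ) ≠ a := fun e => hr (Fin.ext e)
        rw [Function.update_of_ne hr]
        by_cases h1 : (r : ℕ) < a
        · simp [h1, h1.trans (Nat.lt_succ_self a)]
        · rw [if_neg h1, if_neg (by omega)])
    (a := 0) (s := s.setReg 7 0) (c := []) (Nat.zero_le _)
    ⟨rfl, Store.setReg_self _ _ _, .setReg _ le_rfl _, by simpa using hs.setReg (by norm_num) 0⟩
  refine Runs.mono (Runs.seq (B₁ := 1) (L₁ := 0) (Runs.straight (p := zero 7) rfl
    (Runs.seq (B₂ := 1) (L₂ := 1) (hloop.mono le_rfl le_rfl ?_)))) ?_ ?_ fun _ _ h => h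
  · rintro s' c ⟨hc, -, hsame, hH⟩
    obtain rfl : c = [] := by simpa using hc
    refine ⟨s', [G], 1, he s' hsame, le_rfl, le_rfl, rfl, ?_, hsame⟩
    simpa using hH
  · have : (m - 0) * (b.cost + 2) ≤ n * 37 := Nat.mul_le_mul (by omega) (by omega)
    omega
  · omega

/-- Apply a Hadamard gate to the qubit in register `p`. -/
def hadProg (p : ℕ) : Program := eachRow (hadRow p) (emitHad p)

/-- Apply a phase gate to the qubit in register `p`. -/
def phaseProg (p : ℕ) : Program := eachRow (phaseRow p) (emitPhase p)

/-- Apply a CNOT gate from the qubit in register `p` to that in `q`. -/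
def cnotProg (p q : ℕ) : Program := eachRow (cnotRow p q) (emitCnot p q)

/-- The program applies the gate `G` to the stored generators and writes it down. -/
def Applies (p : Program) (G : Gate n) (s : Store) (h : Fin m → SignedPauli n) : Prop :=
  Runs p s (40 * n) 1 fun s' (c : Circuit n) =>
    c = [G] ∧ Holds s' (fun r => G.conj (h r)) ∧ SameRegs s s'

theorem hadProg_applies (hmn : m ≤ n) (hn : 1 ≤ n) {s : Store} {h : Fin m → SignedPauli n}
    (hs : Holds s h) {p : ℕ} (hp : p < 7) (i : Fin n) (hpi : s.reg p = i) :
    Applies (hadProg p) (.had i) s h :=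
  eachRow_runs hmn hn hs rfl rfl (by simp [hadRow, flipReg, cost])
    (fun s' h' r hH h7 hsame => hadRow_spec hH hp i ((hsame p hp).trans hpi) r h7)
    fun s' hsame => by
      have := Exec.emitHad s' p
      rwa [hsame p hp, hpi] at this

theorem phaseProg_applies (hmn : m ≤ n) (hn : 1 ≤ n) {s : Store} {h : Fin m → SignedPauli n}
    (hs : Holds s h) {p : ℕ} (hp : p < 7) (i : Fin n) (hpi : s.reg p = i) :
    Applies (phaseProg p) (.phase i) s h :=
  eachRow_runs hmn hn hs rfl rfl (by simp [phaseRow, flipReg, cost])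
    (fun s' h' r hH h7 hsame => phaseRow_spec hH hp i ((hsame p hp).trans hpi) r h7)
    fun s' hsame => by
      have := Exec.emitPhase s' p
      rwa [hsame p hp, hpi] at this

theorem cnotProg_applies (hmn : m ≤ n) (hn : 1 ≤ n) {s : Store} {h : Fin m → SignedPauli n}
    (hs : Holds s h) {p q : ℕ} (hp : p < 7) (hq : q < 7) (i j : Fin n) (hij : i ≠ j)
    (hpi : s.reg p = i) (hqj : s.reg q = j) :
    Applies (cnotProg p q) (.cnot i j hij) s h :=
  eachRow_runs hmn hn hs rfl rfl (by simp [cnotRow, flipReg, cost])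
    (fun s' h' r hH h7 hsame => cnotRow_spec hH hp hq i j hij ((hsame p hp).trans hpi)
      ((hsame q hq).trans hqj) r h7)
    fun s' hsame => by
      have := Exec.emitCnot s' p q
      rwa [hsame p hp, hpi, hsame q hq, hqj] at this

/-! ### Reducing one generator -/

/-- The program applies a circuit of at most `L` gates to the stored generators, writes it down,
and establishes `Q` for the new generators. -/
def Transforms (p : Program) (s : Store) (B L : ℕ) (h : Fin m → SignedPauli n)
    (Q : (Fin m → SignedPauli n) → Prop) : Prop :=
  Runs p s B L fun s' (c : Circuit n) =>
    Holds s' (fun r => c.conj (h r)) ∧ SameRegs s s' ∧ Q fun r => c.conj (h r)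

theorem Transforms.mono {p : Program} {s : Store} {B B' L L' : ℕ} {h : Fin m → SignedPauli n}
    {Q Q' : (Fin m → SignedPauli n) → Prop} (hp : Transforms p s B L h Q) (hB : B ≤ B')
    (hL : L ≤ L') (hQ : ∀ h', Q h' → Q' h') : Transforms p s B' L' h Q' :=
  Runs.mono hp hB hL fun _ _ h => ⟨h.1, h.2.1, hQ _ h.2.2⟩

theorem Applies.transforms {p : Program} {G : Gate n} {s : Store} {h : Fin m → SignedPauli n}
    (hp : Applies p G s h) {Q : (Fin m → SignedPauli n) → Prop} (hQ : Q fun r => G.conj (h r)) :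
    Transforms p s (40 * n) 1 h Q := by
  refine Runs.mono hp le_rfl le_rfl ?_
  rintro s' c ⟨rfl, hH, hsame⟩
  exact ⟨hH, hsame, hQ⟩

theorem Transforms.seq {p q : Program} {s : Store} {B₁ B₂ L₁ L₂ : ℕ} {h : Fin m → SignedPauli n}
    {Q₁ Q : (Fin m → SignedPauli n) → Prop} (hp : Transforms p s B₁ L₁ h Q₁)
    (hq : ∀ s' h', Holds s' h' → SameRegs s s' → Q₁ h' → Transforms q s' B₂ L₂ h' Q) :
    Transforms (.seq p q) s (B₁ + B₂) (L₁ + L₂) h Q := by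
  refine Runs.seq (Runs.mono hp le_rfl le_rfl ?_)
  rintro s₁ c₁ ⟨hH₁, hs₁, hQ₁⟩
  refine Runs.mono (hq s₁ _ hH₁ hs₁ hQ₁) le_rfl le_rfl ?_
  rintro s₂ c₂ ⟨hH₂, hs₂, hQ₂⟩
  simp only [Circuit.conj_append]
  exact ⟨hH₂, hs₁.trans hs₂, hQ₂⟩

theorem Transforms.ifLt {x y : ℕ} {p q : Program} {s : Store} {B L : ℕ}
    {h : Fin m → SignedPauli n} {Q : (Fin m → SignedPauli n) → Prop}
    (hp : s.reg x < s.reg y → Transforms p s B L h Q)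
    (hq : ¬ s.reg x < s.reg y → Transforms q s B L h Q) :
    Transforms (.ifLt x y p q) s (B + 1) L h Q :=
  Runs.ifLt hp hq

theorem Transforms.skip {s : Store} {h : Fin m → SignedPauli n} (hs : Holds s h)
    {Q : (Fin m → SignedPauli n) → Prop} (hQ : Q h) : Transforms .skip s 1 0 h Q :=
  Runs.straight (p := .skip) rfl ⟨hs, fun _ _ => rfl, hQ⟩

theorem Transforms.load {s : Store} {h : Fin m → SignedPauli n} (hs : Holds s h) {x a i j : ℕ}
    (hx : 7 ≤ x) {p : Program} {B L : ℕ} {Q : (Fin m → SignedPauli n) → Prop}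
    (hp : ∀ s', Holds s' h → SameRegs s s' → s'.reg x = s.arr a (s.reg i) (s.reg j) →
      (∀ y, y ≠ x → s'.reg y = s.reg y) → s'.arr = s.arr → Transforms p s' B L h Q) :
    Transforms (.seq (.load x a i j) p) s (B + 1) L h Q := by
  have hsame : SameRegs s (s.setReg x (s.arr a (s.reg i) (s.reg j))) := .setReg s hx _
  refine Runs.mono (Runs.seq (L₁ := 0) (Runs.straight (p := .load x a i j) rfl
    (Runs.mono (hp _ (hs.setReg (by omega) _) hsame (Store.setReg_self _ _ _)
      (fun y hy => Store.setReg_of_ne _ hy _) rfl) le_rfl le_rfl ?_)))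
    (by simp only [cost]; omega) (by omega) fun _ _ h => h
  rintro s₂ c₂ ⟨hH₂, hs₂, hQ₂⟩
  exact ⟨hH₂, hsame.trans hs₂, hQ₂⟩

/-- Turn the label of row `reg 5` on the qubit in register `p` into `I` or `X`. -/
def normalise (p : ℕ) : Program :=
  seq (load 8 0 5 p) <| seq (load 9 1 5 p) <|
    ifLt 3 9 (ifLt 3 8 (phaseProg p) (hadProg p)) skip

/-- A gate on a qubit beyond `r` meets only the identity in a reduced row; this is why later
elimination preserves earlier rows. -/
theorem Reduced.conj_had {r : ℕ} {P : SignedPauli n} (h : Reduced r P) (i : Fin n) (hi : r < i) :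
    (Gate.had i).conj P = P := by
  have := h.upper i hi
  ext1
  · simp [Gate.conj, this]
  · simp only [Gate.conj, this, Pauli.had]
    rw [← this, Function.update_eq_self]

theorem Reduced.conj_phase {r : ℕ} {P : SignedPauli n} (h : Reduced r P) (i : Fin n)
    (hi : r < i) : (Gate.phase i).conj P = P := by
  have := h.upper i hi
  ext1
  · simp [Gate.conj, this]
  · simp only [Gate.conj, this, Pauli.phase]
    rw [← this, Function.update_eq_self]

theorem Reduced.conj_cnot {r : ℕ} {P : SignedPauli n} (h : Reduced r P) (i j : Fin n)
    (hij : i ≠ j) (hi : r < i) (hj : r < j) : (Gate.cnot i j hij).conj P = P := by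
  have h1 := h.upper i hi
  have h2 := h.upper j hj
  ext1
  · simp [Gate.conj, h1, h2, Pauli.hasX, Pauli.hasZ, Pauli.xBit]
  · funext l
    by_cases hl : l = j
    · subst hl; simp [Gate.conj, h1, h2, Pauli.hasX, Pauli.hasZ, Pauli.xBit, Pauli.zBit, Pauli.ofBits]
    · by_cases hl' : l = i
      · subst hl'
        simp [Gate.conj, h1, h2, Pauli.hasX, Pauli.hasZ, Pauli.xBit, Pauli.zBit, Pauli.ofBits, hij]
      · simp [Gate.conj, hl, hl']

/-- All rows before `i` are reduced. -/
def ReducedBelow (i : Fin m) (h : Fin m → SignedPauli n) : Prop :=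
  ∀ r : Fin m, r < i → Reduced r (h r)

theorem ReducedBelow.conj_cnot {i : Fin m} {h : Fin m → SignedPauli n} (hred : ReducedBelow i h)
    (p q : Fin n) (hpq : p ≠ q) (hp : (i : ℕ) ≤ p) (hq : (i : ℕ) ≤ q) :
    ReducedBelow i fun r => (Gate.cnot p q hpq).conj (h r) := fun r hr => by
  have := Fin.lt_def.1 hr
  simp only [(hred r hr).conj_cnot p q hpq (by omega) (by omega)]
  exact hred r hr

theorem ReducedBelow.conj_had {i : Fin m} {h : Fin m → SignedPauli n} (hred : ReducedBelow i h)
    (p : Fin n) (hp : (i : ℕ) ≤ p) : ReducedBelow i fun r => (Gate.had p).conj (h r) :=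
  fun r hr => by
    have := Fin.lt_def.1 hr
    simp only [(hred r hr).conj_had p (by omega)]
    exact hred r hr

theorem ReducedBelow.conj_phase {i : Fin m} {h : Fin m → SignedPauli n} (hred : ReducedBelow i h)
    (p : Fin n) (hp : (i : ℕ) ≤ p) : ReducedBelow i fun r => (Gate.phase p).conj (h r) :=
  fun r hr => by
    have := Fin.lt_def.1 hr
    simp only [(hred r hr).conj_phase p (by omega)]
    exact hred r hr

/-- Up to sign, the phase gate turns `Y` into `X` and the Hadamard gate turns `Z` into `X`. Signs
are ignored until the row is finished. -/
theorem normalise_transforms (hmn : m ≤ n) (hn : 1 ≤ n) {s : Store} {h : Fin m → SignedPauli n}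
    (hs : Holds s h) {p : ℕ} (hp : p < 7) (i : Fin m) (j : Fin n) (hij : (i : ℕ) ≤ j)
    (h5 : s.reg 5 = i) (hpj : s.reg p = j) (hred : ReducedBelow i h) :
    Transforms (normalise p) s (44 * n) 1 h fun h' => ReducedBelow i h' ∧
      ((h' i).2 j = .I ∨ (h' i).2 j = .X) ∧ ∀ l, l ≠ j → (h' i).2 l = (h i).2 l := by
  refine Transforms.mono (Transforms.load hs (B := 40 * n + 3) (L := 1) (by norm_num)
    fun s₁ hs₁ hsame₁ h8 hne₁ harr₁ => Transforms.load hs₁ (B := 40 * n + 2) (L := 1) (by norm_num)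
      fun s₂ hs₂ hsame₂ h9 hne₂ harr₂ => ?_) (by omega) le_rfl fun _ h => h
  have hsame := hsame₁.trans hsame₂
  rw [hsame₁ 5 (by norm_num), hsame₁ p hp, harr₁, h5, hpj, hs.z] at h9
  rw [← hne₂ 8 (by norm_num), h5, hpj, hs.x] at h8
  have hpj₂ : s₂.reg p = j := (hsame p hp).trans hpj
  refine Transforms.ifLt (B := 40 * n + 1) (fun hz => Transforms.ifLt (B := 40 * n) (fun hx => ?_)
    fun hx => ?_) fun hz => ?_
  · rw [hs₂.zero, h9] at hz
    rw [hs₂.zero, h8] at hx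
    refine (phaseProg_applies hmn hn hs₂ hp j hpj₂).transforms ⟨hred.conj_phase j hij, ?_, ?_⟩
    · cases hP : (h i).2 j <;> simp_all [Gate.conj, Pauli.phase, Pauli.xBit, Pauli.zBit]
    · intro l hl
      simp [Gate.conj, hl]
  · rw [hs₂.zero, h9] at hz
    rw [hs₂.zero, h8] at hx
    refine (hadProg_applies hmn hn hs₂ hp j hpj₂).transforms ⟨hred.conj_had j hij, ?_, ?_⟩
    · cases hP : (h i).2 j <;> simp_all [Gate.conj, Pauli.had, Pauli.xBit, Pauli.zBit]
    · intro l hl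
      simp [Gate.conj, hl]
  · rw [hs₂.zero, h9] at hz
    refine (Transforms.skip hs₂ ⟨hred, ?_, fun _ _ => rfl⟩).mono (by omega) (by omega)
      fun _ h => h
    cases hP : (h i).2 j <;> simp_all [Pauli.zBit]

/-- Make the label of row `reg 5` on qubit `reg 6` trivial, moving it to qubit `reg 5`. -/
def clearColumn : Program :=
  seq (normalise 6) <| seq (load 8 0 5 6) <|
    ifLt 3 8 (seq (load 9 0 5 5) (seq (ifLt 3 9 skip (cnotProg 6 5)) (cnotProg 5 6))) skip

/-- All rows before `i` are reduced, and on the qubits from `i` to `j` row `i` is trivial, except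
for a possible `X` on qubit `i`. -/
structure ClearedTo (i : Fin m) (j : ℕ) (h : Fin m → SignedPauli n) : Prop where
  below : ReducedBelow i h
  pivot : ∀ l : Fin n, (l : ℕ) = i → (h i).2 l = .I ∨ (h i).2 l = .X
  clear : ∀ l : Fin n, (i : ℕ) < l → (l : ℕ) < j → (h i).2 l = .I

/-- If the column holds `X` and the pivot is empty, a CNOT from `j` to `i` copies the `X` to the
pivot; a CNOT from `i` to `j` then cancels it in the column. -/
theorem clearColumn_transforms (hmn : m ≤ n) (hn : 1 ≤ n) {s : Store} {h : Fin m → SignedPauli n}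
    (hs : Holds s h) (i : Fin m) (j : Fin n) (hij : (i : ℕ) < j)
    (h5 : s.reg 5 = i) (h6 : s.reg 6 = j) (hC : ClearedTo i j h) :
    Transforms clearColumn s (130 * n) 3 h (ClearedTo i (j + 1)) := by
  set ι : Fin n := Fin.castLE hmn i with hι
  have hιj : ι ≠ j := fun e => by rw [← e] at hij; simp [hι] at hij
  refine Transforms.mono (Transforms.seq (B₂ := 80 * n + 4) (L₂ := 2)
    (normalise_transforms hmn hn hs (by norm_num) i j hij.le h5 h6 hC.below) ?_)
    (by omega) le_rfl fun _ h => h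
  rintro s₁ h₁ hs₁ hsame₁ ⟨hred₁, hj₁, hne₁⟩
  have hpiv₁ : (h₁ i).2 ι = .I ∨ (h₁ i).2 ι = .X := by
    rw [hne₁ ι hιj]; exact hC.pivot ι rfl
  have h5₁ : s₁.reg 5 = i := (hsame₁ 5 (by norm_num)).trans h5
  have h6₁ : s₁.reg 6 = j := (hsame₁ 6 (by norm_num)).trans h6
  -- the conclusion only concerns the labels of row `i` on the two qubits
  have hfin : ∀ h' : Fin m → SignedPauli n, ReducedBelow i h' → (h' i).2 j = .I →
      ((h' i).2 ι = .I ∨ (h' i).2 ι = .X) → (∀ l, l ≠ j → l ≠ ι → (h' i).2 l = (h₁ i).2 l) →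
      ClearedTo i (j + 1) h' := by
    intro h' hr hj hp hl
    refine ⟨hr, fun l e => ?_, fun l hil hlj => ?_⟩
    · rwa [show l = ι from Fin.ext e]
    · by_cases e : l = j
      · rwa [e]
      · have e' : (l : ℕ) ≠ j := fun e' => e (Fin.ext e')
        rw [hl l e (fun e' => by rw [e'] at hil; simp [hι] at hil), hne₁ l e]
        exact hC.clear l hil (by omega)
  refine (Transforms.load hs₁ (B := 80 * n + 3) (L := 2) (by norm_num)
    fun s₂ hs₂ hsame₂ h8 _ _ => Transforms.ifLt (B := 80 * n + 2) (fun hx => ?_) fun hx => ?_)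
  · rw [hs₂.zero, h8, h5₁, h6₁, hs₁.x] at hx
    have hjX : (h₁ i).2 j = .X := by
      rcases hj₁ with e | e
      · simp [e, Pauli.xBit] at hx
      · exact e
    have h5₂ : s₂.reg 5 = i := (hsame₂ 5 (by norm_num)).trans h5₁
    have h6₂ : s₂.reg 6 = j := (hsame₂ 6 (by norm_num)).trans h6₁
    refine Transforms.load hs₂ (B := 80 * n + 1) (L := 2) (by norm_num)
      fun s₃ hs₃ hsame₃ h9 _ _ => ?_
    rw [h5₂, show s₂.arr 0 i i = ((h₁ i).2 ι).xBit from hs₂.x i ι] at h9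
    have h5₃ : s₃.reg 5 = i := (hsame₃ 5 (by norm_num)).trans h5₂
    have h6₃ : s₃.reg 6 = j := (hsame₃ 6 (by norm_num)).trans h6₂
    refine Transforms.mono (Transforms.seq (B₁ := 40 * n + 1) (L₁ := 1) (B₂ := 40 * n) (L₂ := 1)
      (Q₁ := fun h' => ReducedBelow i h' ∧ (h' i).2 j = .X ∧ (h' i).2 ι = .X ∧
        ∀ l, l ≠ j → l ≠ ι → (h' i).2 l = (h₁ i).2 l)
      (Transforms.ifLt (fun hp => ?_) fun hp => ?_) ?_) (by omega) le_rfl fun _ h => h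
    · rw [hs₃.zero, h9] at hp
      refine (Transforms.skip hs₃ ⟨hred₁, hjX, ?_, fun _ _ _ => rfl⟩).mono (by omega) (by omega)
        fun _ h => h
      rcases hpiv₁ with e | e
      · simp [e, Pauli.xBit] at hp
      · exact e
    · rw [hs₃.zero, h9] at hp
      have hpI : (h₁ i).2 ι = .I := by
        rcases hpiv₁ with e | e
        · exact e
        · simp [e, Pauli.xBit] at hp
      refine (cnotProg_applies hmn hn hs₃ (by norm_num) (by norm_num) j ι hιj.symm h6₃
        h5₃).transforms ⟨hred₁.conj_cnot _ _ _ hij.le le_rfl, ?_, ?_, fun l hl hl' => ?_⟩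
      · simp [Gate.conj, hιj.symm, hjX, hpI, Pauli.ofBits, Pauli.hasX, Pauli.hasZ, Pauli.xBit,
          Pauli.zBit]
      · simp [Gate.conj, hjX, hpI, Pauli.ofBits, Pauli.hasX, Pauli.hasZ, Pauli.xBit, Pauli.zBit]
      · simp [Gate.conj, hl, hl']
    · rintro s₄ h₄ hs₄ hsame₄ ⟨hred₄, hj₄, hp₄, hl₄⟩
      refine (cnotProg_applies hmn hn hs₄ (by norm_num) (by norm_num) ι j hιj
        ((hsame₄ 5 (by norm_num)).trans h5₃) ((hsame₄ 6 (by norm_num)).trans h6₃)).transforms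
        (hfin _ (hred₄.conj_cnot _ _ _ le_rfl hij.le) ?_ (Or.inr ?_) fun l hl hl' => ?_)
      · simp [Gate.conj, hj₄, hp₄, Pauli.ofBits, Pauli.hasX, Pauli.hasZ, Pauli.xBit, Pauli.zBit]
      · simp [Gate.conj, hιj, hj₄, hp₄, Pauli.ofBits, Pauli.hasX, Pauli.hasZ, Pauli.xBit,
          Pauli.zBit]
      · simp [Gate.conj, hl, hl', hl₄]
  · rw [hs₂.zero, h8, h5₁, h6₁, hs₁.x] at hx
    refine (Transforms.skip hs₂ (hfin _ hred₁ ?_ hpiv₁ fun _ _ _ => rfl)).mono (by omega)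
      (by omega) fun _ h => h
    rcases hj₁ with e | e
    · exact e
    · simp [e, Pauli.xBit] at hx

/-- Turn `± X` on qubit `reg 5` in row `reg 5` into `Z` with the sign `+`. -/
def finishRow : Program :=
  seq (hadProg 5) <| seq (load 8 2 5 3) <|
    ifLt 3 8 (seq (hadProg 5) (seq (phaseProg 5) (seq (phaseProg 5) (hadProg 5)))) skip

/-- A Hadamard gate turns the pivot into `Z`. A sign `-` is removed by `H R R H = H Z H = X`, which
anticommutes with the `Z` on the pivot and leaves the other qubits alone. -/
theorem finishRow_transforms (hmn : m ≤ n) (hn : 1 ≤ n) {s : Store} {h : Fin m → SignedPauli n}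
    (hs : Holds s h) (i : Fin m) (h5 : s.reg 5 = i) (hred : ReducedBelow i h)
    (hlow : ∀ l : Fin n, (l : ℕ) < i → (h i).2 l = .I ∨ (h i).2 l = .Z)
    (hpiv : (h i).2 (Fin.castLE hmn i) = .X)
    (hup : ∀ l : Fin n, (i : ℕ) < l → (h i).2 l = .I) :
    Transforms finishRow s (205 * n) 5 h fun h' => ∀ r : Fin m, r ≤ i → Reduced r (h' r) := by
  set ι : Fin n := Fin.castLE hmn i with hι
  have hιi : (ι : ℕ) = i := rfl
  have hfin : ∀ h' : Fin m → SignedPauli n, ReducedBelow i h' → (h' i).1 = false →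
      (h' i).2 ι = .Z → (∀ l, l ≠ ι → (h' i).2 l = (h i).2 l) →
      ∀ r : Fin m, r ≤ i → Reduced r (h' r) := by
    intro h' hr hs' hp hl r hri
    rcases hri.eq_or_lt with rfl | hri
    · refine ⟨hs', fun l e => by rwa [show l = ι from Fin.ext e], fun l e => ?_, fun l e => ?_⟩
      · rw [hl l (fun e' => by rw [e'] at e; omega)]
        exact hlow l e
      · rw [hl l (fun e' => by rw [e'] at e; omega)]
        exact hup l e
    · exact hr r hri
  refine Transforms.mono (Transforms.seq (B₁ := 40 * n) (L₁ := 1) (B₂ := 160 * n + 2) (L₂ := 4)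
    (Q₁ := fun h' => ReducedBelow i h' ∧ (h' i).2 ι = .Z ∧ ∀ l, l ≠ ι → (h' i).2 l = (h i).2 l)
    ((hadProg_applies hmn hn hs (by norm_num) ι h5).transforms
      ⟨hred.conj_had ι le_rfl, ?_, fun l hl => ?_⟩) ?_) (by omega) le_rfl fun _ h => h
  · simp [Gate.conj, hpiv, Pauli.had]
  · simp [Gate.conj, hl]
  · rintro s₁ h₁ hs₁ hsame₁ ⟨hred₁, hZ, hl₁⟩
    have h5₁ : s₁.reg 5 = ι := (hsame₁ 5 (by norm_num)).trans h5
    refine Transforms.load hs₁ (B := 160 * n + 1) (L := 4) (by norm_num)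
      fun s₂ hs₂ hsame₂ h8 _ _ => Transforms.ifLt (B := 160 * n) (fun hx => ?_) fun hx => ?_
    · rw [hs₂.zero, h8, hs₁.zero, h5₁, hιi, hs₁.sign] at hx
      have hsg : (h₁ i).1 = true := by
        cases e : (h₁ i).1
        · simp [e] at hx
        · rfl
      have h5₂ : s₂.reg 5 = ι := (hsame₂ 5 (by norm_num)).trans h5₁
      refine Transforms.mono (Transforms.seq (B₂ := 40 * n + (40 * n + 40 * n)) (L₂ := 1 + (1 + 1))
        (Q₁ := fun h' => h' = fun r => (Gate.had ι).conj (h₁ r))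
        ((hadProg_applies hmn hn hs₂ (by norm_num) ι h5₂).transforms rfl) ?_) (by omega) le_rfl
          fun _ h => h
      rintro s₃ _ hs₃ hsame₃ rfl
      have h5₃ : s₃.reg 5 = ι := (hsame₃ 5 (by norm_num)).trans h5₂
      refine Transforms.seq
        (Q₁ := fun h' => h' = fun r => (Gate.phase ι).conj ((Gate.had ι).conj (h₁ r)))
        ((phaseProg_applies hmn hn hs₃ (by norm_num) ι h5₃).transforms rfl) ?_
      rintro s₄ _ hs₄ hsame₄ rfl
      have h5₄ : s₄.reg 5 = ι := (hsame₄ 5 (by norm_num)).trans h5₃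
      refine Transforms.seq (Q₁ := fun h' => h' = fun r =>
          (Gate.phase ι).conj ((Gate.phase ι).conj ((Gate.had ι).conj (h₁ r))))
        ((phaseProg_applies hmn hn hs₄ (by norm_num) ι h5₄).transforms rfl) ?_
      rintro s₅ _ hs₅ hsame₅ rfl
      have h5₅ : s₅.reg 5 = ι := (hsame₅ 5 (by norm_num)).trans h5₄
      refine (hadProg_applies hmn hn hs₅ (by norm_num) ι h5₅).transforms (hfin _
        ((((hred₁.conj_had ι le_rfl).conj_phase ι le_rfl).conj_phase ι le_rfl).conj_had ι le_rfl)
        ?_ ?_ fun l hl => ?_)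
      · simp [Gate.conj, hsg, hZ, Pauli.had, Pauli.phase]
      · simp [Gate.conj, hZ, Pauli.had, Pauli.phase]
      · simp [Gate.conj, hl, hl₁]
    · rw [hs₂.zero, h8, hs₁.zero, h5₁, hιi, hs₁.sign] at hx
      refine (Transforms.skip hs₂ (hfin _ hred₁ ?_ hZ hl₁)).mono (by omega) (by omega)
        fun _ h => h
      cases e : (h₁ i).1
      · rfl
      · simp [e] at hx

/-! ### The encoding finder -/

/-- Reduce row `reg 5`. -/
def reduceRow : Program :=
  seq (normalise 5) <| seq (copy 6 5) <| seq (succ 6) <|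
    seq (whileLt 6 0 (seq clearColumn (succ 6))) finishRow

theorem reduceRow_runs (hmn : m ≤ n) (hn : 1 ≤ n) {s : Store} {h : Fin m → SignedPauli n}
    (hs : Holds s h) (hind : IndepGenerators h) (i : Fin m) (h5 : s.reg 5 = i)
    (hred : ReducedBelow i h) :
    Runs reduceRow s (400 * n ^ 2) (9 * n) fun s' (c : Circuit n) =>
      Holds s' (fun r => c.conj (h r)) ∧ s'.reg 5 = i ∧
        ∀ r : Fin m, r ≤ i → Reduced r (c.conj (h r)) := by
  have hn2 : n ≤ n ^ 2 := Nat.le_self_pow (by norm_num) n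
  refine Runs.mono (Runs.seq (B₂ := 1 + (1 + (n * (130 * n + 2) + 1 + 205 * n)))
    (L₂ := 0 + (0 + (n * 3 + 5)))
    (Runs.mono (normalise_transforms hmn hn hs (by norm_num) i (Fin.castLE hmn i) le_rfl h5 h5 hred)
      le_rfl le_rfl ?_)) ?_ (by omega) fun _ _ h => h
  swap
  · have : n * (130 * n + 2) = 130 * n ^ 2 + 2 * n := by ring
    omega
  rintro s₁ c₁ ⟨hs₁, hsame₁, hred₁, hpiv₁, -⟩
  have h5₁ : s₁.reg 5 = i := (hsame₁ 5 (by norm_num)).trans h5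
  refine Runs.seq (Runs.straight (p := copy 6 5) rfl (Runs.seq (Runs.straight (p := succ 6) rfl ?_)))
  set s₂ := (succ 6).eval ((copy 6 5).eval s₁) with hs₂
  have hs₂' : s₂ = (s₁.setReg 6 i).setReg 6 (i + 1) := by
    rw [hs₂]
    simp only [eval, Store.setReg_self, h5₁]
  let Inv : ℕ → Store → Circuit n → Prop := fun a s' c => Holds s' (fun r => c.conj (h r)) ∧
    s'.reg 5 = i ∧ s'.reg 6 = a ∧ (i : ℕ) < a ∧ ClearedTo i a fun r => c.conj (h r)
  have hloop := Runs.loop (x := 6) (y := 0) (N := n) (B := 130 * n) (L := 3) (b := clearColumn) Inv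
    (fun a s' c hI => ⟨hI.2.2.1, hI.1.cols⟩) (by
      rintro a s' c ha ⟨hH, h5', h6', hia, hC⟩
      refine Runs.mono (clearColumn_transforms hmn hn hH i ⟨a, ha⟩ hia h5' h6' hC) le_rfl le_rfl ?_
      rintro s'' d ⟨hH', hsame', hC'⟩
      simp only [← Circuit.conj_append] at hH' hC'
      exact ⟨(hsame' 6 (by norm_num)).trans h6', hH'.setReg (by norm_num) _,
        (Store.setReg_of_ne _ (by norm_num) _).trans ((hsame' 5 (by norm_num)).trans h5'),
        Store.setReg_self _ _ _, by omega, hC'⟩)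
    (a := i + 1) (s := s₂) (c := c₁) (by omega) (by
      rw [hs₂']
      exact ⟨(hs₁.setReg (by norm_num) _).setReg (by norm_num) _, h5₁, Store.setReg_self _ _ _,
        Nat.lt_succ_self _, hred₁, fun l e => by rwa [show l = Fin.castLE hmn i from Fin.ext e],
        fun l h1 h2 => by omega⟩)
  refine Runs.seq (Runs.mono hloop ?_ ?_ ?_)
  · have := Nat.mul_le_mul_right (130 * n + 2) (Nat.sub_le n (i + 1))
    omega
  · omega
  rintro s₃ c₃ ⟨hs₃, h5₃, -, -, hC₃⟩
  have hup : ∀ l : Fin n, (i : ℕ) < l → (Circuit.conj (c₁ ++ c₃) (h i)).2 l = .I :=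
    fun l hl => hC₃.clear l hl l.2
  -- Only here does independence enter: clearing the columns may have left `I` on the pivot, and
  -- `row_spec` excludes this.
  obtain ⟨hlow, hpiv⟩ := (hind.conj (c₁ ++ c₃)).row_spec hmn i hC₃.below hup
  have hX := (hC₃.pivot (Fin.castLE hmn i) rfl).resolve_left hpiv
  refine Runs.mono (finishRow_transforms hmn hn hs₃ i h5₃ hC₃.below hlow hX hup) le_rfl le_rfl ?_
  rintro s₄ c₄ ⟨hs₄, hsame₄, hR⟩
  simp only [← Circuit.conj_append, List.append_assoc] at hs₄ hR
  exact ⟨by simpa using hs₄, (hsame₄ 5 (by norm_num)).trans h5₃, by simpa using hR⟩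

/-- The encoding finder: compute the number `n - k` of generators, then reduce them one by one. -/
def encodingFinder : Program :=
  seq (copy 8 1) <| seq (whileLt 8 0 (seq (succ 2) (succ 8))) <|
    seq (zero 5) (whileLt 5 2 (seq reduceRow (succ 5)))

theorem encodingFinder_runs (hn : 1 ≤ n) (hk : k ≤ n) (g : Fin (n - k) → SignedPauli n)
    (hg : IndepGenerators g) :
    Runs encodingFinder (inputStore k g) (410 * n ^ 3) (9 * n ^ 2) fun _ (c : Circuit n) =>
      ∀ r : Fin (n - k), Reduced r (c.conj (g r)) := by
  have hn3 : n ≤ n ^ 3 := Nat.le_self_pow (by norm_num) n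
  -- The machine has no subtraction: `n - k` is obtained by counting register `8` up from `k` to
  -- `n`.
  let Inv : ℕ → Store → Circuit n → Prop := fun a s' c => c = [] ∧ s'.arr = (inputStore k g).arr ∧
    s'.reg 0 = n ∧ s'.reg 2 = a - k ∧ s'.reg 3 = 0 ∧ s'.reg 8 = a ∧ k ≤ a
  have hloop := Runs.loop (n := n) (x := 8) (y := 0) (N := n) (B := 1) (L := 0) (b := succ 2) Inv
    (fun a s' c hI => ⟨hI.2.2.2.2.2.1, hI.2.2.1⟩) (by
      rintro a s' c ha ⟨rfl, harr, h0, h2, h3, h8, hka⟩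
      refine Runs.straight (p := succ 2) rfl ⟨h8, rfl, harr, ?_, ?_, ?_, Store.setReg_self _ _ _, by omega⟩
      · simpa [eval, Store.setReg] using h0
      · simp [eval, Store.setReg, h2]
        omega
      · simpa [eval, Store.setReg] using h3)
    (a := k) (s := (copy 8 1).eval (inputStore k g)) (c := []) hk
    ⟨rfl, rfl, by simp [eval, Store.setReg, inputStore], by simp [eval, Store.setReg, inputStore],
      by simp [eval, Store.setReg, inputStore], by simp [eval, Store.setReg, inputStore], le_rfl⟩
  refine Runs.mono (Runs.seq (B₁ := 1) (B₂ := n * 3 + 1 + (1 + (n * (400 * n ^ 2 + 2) + 1))) (L₁ := 0)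
    (L₂ := 0 + (0 + n * (9 * n))) (Runs.straight (p := copy 8 1) rfl (Runs.seq (Runs.mono hloop ?_ ?_ ?_))))
    ?_ ?_ fun _ _ h => h
  · omega
  · omega
  · rintro s₁ c₁ ⟨hc₁, harr, h0, h2, h3, -, -⟩
    obtain rfl : c₁ = [] := by simpa using hc₁
    refine Runs.seq (Runs.straight (p := zero 5) rfl ?_)
    have hs₁ : Holds s₁ g := by
      refine ⟨h0, h2, h3, fun r q => ?_, fun r q => ?_, fun r => ?_⟩ <;> rw [harr]
      · simp [inputStore]
      · simp [inputStore]
      · have : 0 < n := hn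
        cases e : (g r).1 <;> simp [inputStore, this, e]
    have hloop2 := Runs.loop (x := 5) (y := 2) (N := n - k) (B := 400 * n ^ 2) (L := 9 * n)
      (b := reduceRow) (fun a s' c => Holds s' (fun r => c.conj (g r)) ∧ s'.reg 5 = a ∧
        ∀ r : Fin (n - k), (r : ℕ) < a → Reduced r (c.conj (g r)))
      (fun a s' c hI => ⟨hI.2.1, hI.1.rows⟩) (by
        rintro a s' c ha ⟨hH, h5, hR⟩
        refine Runs.mono (reduceRow_runs (Nat.sub_le n k) hn hH (hg.conj c) ⟨a, ha⟩ h5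
          fun r hr => hR r hr) le_rfl le_rfl ?_
        rintro s'' d ⟨hH', h5', hR'⟩
        simp only [← Circuit.conj_append] at hH' hR'
        exact ⟨h5', hH'.setReg (by norm_num) _, Store.setReg_self _ _ _,
          fun r hr => hR' r (Fin.le_def.2 (Nat.lt_succ_iff.1 hr))⟩)
      (a := 0) (s := (zero 5).eval s₁) (c := []) (Nat.zero_le _)
      ⟨hs₁.setReg (by norm_num) 0, Store.setReg_self _ _ _,
        fun r hr => by omega⟩
    refine Runs.mono hloop2 ?_ ?_ ?_
    · have := Nat.mul_le_mul_right (400 * n ^ 2 + 2) (show n - k - 0 ≤ n by omega)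
      omega
    · exact Nat.mul_le_mul_right _ (by omega)
    · rintro s₂ c₂ ⟨-, -, hR⟩ r
      simpa using hR r r.2
  · have : n * (400 * n ^ 2 + 2) = 400 * n ^ 3 + 2 * n := by ring
    omega
  · have : n * (9 * n) = 9 * n ^ 2 := by ring
    omega

/-! ### From reduced generators to an encoding -/

/-- Both `I` and `Z` fix `|0⟩`, and a reduced row acts trivially on the last `k` qubits. Hence its
possible `Z` labels before the pivot need not be eliminated. -/
theorem Reduced.mulVec_zeroPad (hk : k ≤ n) {r : ℕ} (hr : r < n - k) {P : SignedPauli n}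
    (hP : Reduced r P) (ψ : Bits k → ℂ) : P.mat *ᵥ zeroPad hk ψ = zeroPad hk ψ := by
  rw [SignedPauli.mat_eq, hP.sign, show sgn false = 1 by simp [sgn], one_smul]
  ext a
  -- The sum is compared termwise with the identity matrix: terms outside the zero-padded strings
  -- vanish, and in the others the matrix entries agree.
  conv_rhs => rw [← Matrix.one_mulVec (zeroPad hk ψ)]
  refine Finset.sum_congr rfl fun b _ => ?_
  by_cases hb : ∀ j : Fin n, (j : ℕ) < n - k → b j = 0
  · congr 1
    have hfac : ∀ l, (P.2 l).mat (a l) (b l) = if a l = b l then 1 else 0 := by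
      intro l
      by_cases hl : (l : ℕ) < n - k
      · rw [hb l hl]
        generalize a l = x
        rcases hP.isZ l with e | e <;> rw [e] <;> fin_cases x <;> simp [Pauli.mat, Matrix.one_fin_two]
      · rw [hP.upper l (by omega)]
        exact Matrix.one_apply
    simp only [PauliString.mat, tensor, Matrix.of_apply, hfac, Finset.prod_ite_zero,
      Finset.prod_const_one, Matrix.one_apply]
    simp [funext_iff]
  · simp [zeroPad, hb]

/-- Being fixed passes from the generators to their products, so it suffices to check generators,
each of which is moved through `U`. -/
theorem isEncoding_of_reduced (hk : k ≤ n) {S : Finset (SignedPauli n)}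
    {g : Fin (n - k) → SignedPauli n} (hg : Generates g S) (c : Circuit n)
    (hc : ∀ r : Fin (n - k), Reduced r (c.conj (g r))) : IsEncoding hk c.mat S := by
  intro ψ P hP
  have hmem : P.mat ∈ Submonoid.closure (Set.range fun r => (g r).mat) := by
    rw [← SetLike.mem_coe, ← hg]
    exact ⟨P, hP, rfl⟩
  generalize P.mat = M at hmem
  induction hmem using Submonoid.closure_induction with
  | mem x hx =>
    obtain ⟨r, rfl⟩ := hx
    simp only
    rw [Matrix.mulVec_mulVec, ← Circuit.mat_mul_conj, ← Matrix.mulVec_mulVec,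
      (hc r).mulVec_zeroPad hk r.2]
  | one => exact Matrix.one_mulVec _
  | mul x y _ _ hx hy => rw [← Matrix.mulVec_mulVec, hy, hx]

theorem encodingFinder_findsEncodings : FindsEncodings encodingFinder := by
  refine ⟨410, fun n k hn hk S g hg => ?_⟩
  obtain ⟨s', c, t, he, ht, hl, hc⟩ := encodingFinder_runs hn hk g (S.2.indepGenerators hg)
  exact ⟨c, t, ⟨s', he⟩, ht, hl.trans (Nat.mul_le_mul_right _ (by norm_num)),
    isEncoding_of_reduced hk hg c hc⟩

/-! ### Running time and the main theorem -/

theorem Algorithm1RunsIn.mono {F : Program} {n k B B' : ℕ} (h : Algorithm1RunsIn F n k B)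
    (hB : B ≤ B') : Algorithm1RunsIn F n k B' := fun S g hg => by
  obtain ⟨c, t, hw, ht⟩ := h S g hg
  exact ⟨c, t, hw, ht.trans hB⟩

theorem FindsEncodings.algorithm1RunsIn {F : Program} (hF : FindsEncodings F) :
    ∃ C : ℕ, ∀ n k : ℕ, 1 ≤ n → k ≤ n → Algorithm1RunsIn F n k (C * n ^ 3) := by
  obtain ⟨C, hC⟩ := hF
  -- The finder takes `C n^3` steps, the inverse circuit has at most `3 C n^2` gates since an
  -- inverse phase gate counts three, and measurement and output cost `n + k ≤ 2 n`.
  refine ⟨4 * C + 2, fun n k hn hk S g hg => ?_⟩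
  obtain ⟨c, t, hw, ht, hl, -⟩ := hC n k hn hk S g hg
  refine ⟨c, t, hw, ?_⟩
  have h1 : n ≤ n ^ 3 := Nat.le_self_pow (by norm_num) n
  have h2 : C * n ^ 2 ≤ C * n ^ 3 := Nat.mul_le_mul_left C (Nat.pow_le_pow_right hn (by norm_num))
  have h3 := c.inv_length_le
  rw [algorithm1Time, show (4 * C + 2) * n ^ 3 = 4 * (C * n ^ 3) + 2 * n ^ 3 by ring]
  omega

end LSN

open LSN
theorem mainTheorem10 :
    (∃ F : Program, FindsEncodings F) ∧
    ∀ F : Program, FindsEncodings F →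
      -- the running time is `O(n ^ 3)`
      (∃ C : ℕ, ∀ n k : ℕ, 1 ≤ n → k ≤ n → Algorithm1RunsIn F n k (C * n ^ 3)) ∧
      -- in particular it is `poly(k)` whenever `n = poly(k)`
      (∀ N : ℕ → ℕ, (∀ k, 1 ≤ N k ∧ k ≤ N k) → (∃ q : Polynomial ℕ, ∀ k, N k ≤ q.eval k) →
        ∃ q : Polynomial ℕ, ∀ k, Algorithm1RunsIn F (N k) k (q.eval k)) ∧
      -- the success probability for the noise rate `1 / n`, where `Stab(n, k)` is described by any
      -- choice `desc` of generators and `enc S` is the encoding circuit that `F` finds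
      (∀ (n k : ℕ) (_ : 1 ≤ n) (hk : k ≤ n) (desc : Stab n k → Fin (n - k) → SignedPauli n),
        (∀ S, Generates (desc S) S.1) →
        ∃ enc : Stab n k → Circuit n,
          (∀ S, IsEncoding hk (enc S).mat S.1 ∧ ∃ t, Writes F k (desc S) (enc S) t) ∧
          0.25 ≤ successProb hk (1 / (n : ℝ)) (fun S => (enc S).mat)
            (fun S => algorithm1Output hk (enc S))) := by
  refine ⟨⟨encodingFinder, encodingFinder_findsEncodings⟩, fun F hF => ?_⟩
  obtain ⟨C, hC⟩ := hF.algorithm1RunsIn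
  refine ⟨⟨C, hC⟩, fun N hN ⟨q, hq⟩ => ⟨Polynomial.C C * q ^ 3, fun k => ?_⟩,
    fun n k hn hk desc hdesc => ?_⟩
  · refine (hC (N k) k (hN k).1 (hN k).2).mono ?_
    rw [Polynomial.eval_mul, Polynomial.eval_C, Polynomial.eval_pow]
    exact Nat.mul_le_mul_left C (Nat.pow_le_pow_left (hq k) 3)
  · obtain ⟨C', hC'⟩ := hF
    -- Each description yields a circuit that the finder writes; the success bound then applies to
    -- this family as to any other.
    choose enc t hw _ _ henc using fun S => hC' n k hn hk S (desc S) (hdesc S)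
    exact ⟨enc, fun S => ⟨henc S, t S, hw S⟩, quarter_le_successProb hn hk enc⟩
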